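/- **Notation.** Let $n\ge 2$ and let $f=f_0X^n+f_1X^{n-1}+\dots+f_n\in\mathbb Z[X]$ have degree $n$ (so $f_0\ne0$), with complex zeros $\alpha_1,\dots,\alpha_n$ counted with multiplicity. Put $$[f](X_1,\dots,X_n)=f_0^{\,n-1}\prod_{i=1}^n\left(\alpha_i^{n-1}X_1+\alpha_i^{n-2}X_2+\dots+X_n\right).$$ Let $f,g\in\mathbb Z[X]$ be of degree $n$. * $f,g$ are *Hermite equivalent* if $[g](U\underline X)=\pm[f](\underline X)$ for some $U\in\mathrm{GL}_n(\mathbb Z)$, where $\underline X=(X_1,\dots,X_n)^T$. * $f,g$ are *$\mathrm{GL}_2(\mathbb Z)$-equivalent* if their degree-$n$ homogenizations $F(X,Y)=Y^nf(X/Y)$ and $G(X,Y)=Y^ng(X/Y)$ satisfy $G(X,Y)=\pm F(aX+bY,cX+dY)$ for some $\begin{pmatrix}a&b\\c&d\end{pmatrix}\in\mathrm{GL}_2(\mathbb Z)$. * Monic $f,g$ are *$\mathbb Z$-equivalent* if $g(X)=\varepsilon^nf(\varepsilon X+a)$ for some $\varepsilon\in\{\pm1\}$, $a\in\mathbb Z$.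 Let $K_f=\mathbb Q[X]/(f)$, let $\alpha$ be the class of $X$ in $K_f$, and put $\zeta_i=f_0\alpha^i+f_1\alpha^{i-1}+\dots+f_{i-1}\alpha$. The *invariant order* $R_f\subset K_f$ is the ring with $\mathbb Z$-basis $1,\zeta_1,\dots,\zeta_{n-1}$, and the *invariant ideal* $I_f$ is the fractional $R_f$-ideal in $K_f$ generated by $1$ and $\alpha$. **Theorem 1.1.** Let $n\ge2$. (i) Let $f,g\in\mathbb Z[X]$ have degree $n$ and nonzero discriminant. Then $f$ and $g$ are Hermite equivalent if and only if there is a ring isomorphism $\varphi:R_f\to R_g$ under which $I_f^{n-1}$ and $I_g^{n-1}$ belong to the same ideal class, that is, such that $\varphi$ extends to a $\mathbb Q$-algebra isomorphism $\Phi:K_f\to K_g$ with $\Phi(I_f^{n-1})=\kappa I_g^{n-1}$ for some $\kappa\in K_g^\times$. Moreover, if $f$ and $g$ are Hermite equivalent, then every $\mathbb Q$-algebra isomorphism $\Phi:K_f\to K_g$ such that $\Phi(I_f^{n-1})=\kappa I_g^{n-1}$ for some $\kappa\in K_g^\times$ maps $R_f$ onto $R_g$. (ii) Let $f,g\in\mathbb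 Z[X]$ be monic of degree $n$ with nonzero discriminant. Then $f$ and $g$ are Hermite equivalent if and only if $R_f$ and $R_g$ are isomorphic as rings. (iii) Let $f,g\in\mathbb Z[X]$ have degree $n$ (the discriminant may be zero). If $f$ and $g$ are $\mathrm{GL}_2(\mathbb Z)$-equivalent, then they are Hermite equivalent. In particular, if $f$ and $g$ are monic and $\mathbb Z$-equivalent, then they are Hermite equivalent. -/

import Mathlib

open Polynomial

noncomputable section

/-- The linear substitution `P(X) ↦ P(A X)`, with `X` the column vector of the variables. -/
def linSubst {ι R : Type*} [Fintype ι] [CommRing R] (A : Matrix ι ι R) (P : MvPolynomial ι R) :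
    MvPolynomial ι R :=
  MvPolynomial.bind₁ (fun i => ∑ j, MvPolynomial.C (A i j) * MvPolynomial.X j) P

/-- The decomposable form `[f]` attached to a polynomial `f` of degree `n`:
`[f](X₁, …, Xₙ) = f₀ ^ (n - 1) * ∏ᵢ (αᵢ ^ (n - 1) X₁ + αᵢ ^ (n - 2) X₂ + ⋯ + Xₙ)`,
with `f₀` the leading coefficient and `α₁, …, αₙ` the complex zeros of `f`, with multiplicity.
The variable `X_{i+1}` is indexed by `i : Fin n`. -/
def hermiteForm (n : ℕ) (f : ℤ[X]) : MvPolynomial (Fin n) ℂ :=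
  MvPolynomial.C ((f.leadingCoeff : ℂ) ^ (n - 1)) *
    ((f.map (Int.castRingHom ℂ)).roots.map fun α =>
      ∑ i : Fin n, MvPolynomial.C (α ^ (n - 1 - (i : ℕ))) * MvPolynomial.X i).prod

/-- Hermite equivalence of two polynomials `f`, `g` of degree `n`: `[g](U X) = ± [f](X)` for some
`U ∈ GL_n(ℤ)`. -/
def HermiteEquivalent (n : ℕ) (f g : ℤ[X]) : Prop :=
  ∃ U : GL (Fin n) ℤ,
    linSubst ((U : Matrix (Fin n) (Fin n) ℤ).map (Int.cast : ℤ → ℂ)) (hermiteForm n g)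
        = hermiteForm n f ∨
      linSubst ((U : Matrix (Fin n) (Fin n) ℤ).map (Int.cast : ℤ → ℂ)) (hermiteForm n g)
        = -hermiteForm n f

/-- `GL₂(ℤ)`-equivalence of two polynomials `f`, `g` of degree `n`: the homogenizations `F`, `G` of
degree `n` satisfy `G(X, Y) = ± F(aX + bY, cX + dY)` for some matrix `(a b; c d) ∈ GL₂(ℤ)`. -/
def GL2Equivalent (n : ℕ) (f g : ℤ[X]) : Prop :=
  ∃ γ : GL (Fin 2) ℤ,
    g.homogenize n = linSubst (γ : Matrix (Fin 2) (Fin 2) ℤ) (f.homogenize n) ∨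
      g.homogenize n = -linSubst (γ : Matrix (Fin 2) (Fin 2) ℤ) (f.homogenize n)

/-- `ℤ`-equivalence of two monic polynomials `f`, `g` of degree `n`: `g(X) = ε ^ n f(ε X + a)` for
some `ε ∈ {1, -1}` and `a ∈ ℤ`. -/
def ZEquivalent (n : ℕ) (f g : ℤ[X]) : Prop :=
  ∃ (ε : ℤˣ) (a : ℤ), g = C ((ε : ℤ) ^ n) * f.comp (C (ε : ℤ) * X + C a)

/-- The `ℚ`-algebra `K_f = ℚ[X] / (f)`. -/
abbrev rootAlgebra (f : ℤ[X]) : Type :=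
  AdjoinRoot (f.map (Int.castRingHom ℚ))

/-- The residue class `α` of `X` in `K_f`. -/
def rootClass (f : ℤ[X]) : rootAlgebra f :=
  AdjoinRoot.root (f.map (Int.castRingHom ℚ))

/-- The elements `ζᵢ = f₀ α ^ i + f₁ α ^ (i - 1) + ⋯ + f_{i-1} α` of `K_f`, where
`f = f₀ X ^ n + f₁ X ^ (n - 1) + ⋯ + fₙ` has degree `n`. -/
def zetaElt (f : ℤ[X]) (i : ℕ) : rootAlgebra f :=
  ∑ j ∈ Finset.range i, (f.coeff (f.natDegree - j) : rootAlgebra f) * rootClass f ^ (i - j)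

/-- The additive subgroup of `K_f` generated by `1, ζ₁, …, ζ_{n-1}`, with `n` the degree of `f`. -/
def orderSpan (f : ℤ[X]) : AddSubgroup (rootAlgebra f) :=
  AddSubgroup.closure (insert 1 (zetaElt f '' Set.Ico 1 f.natDegree))

theorem zetaElt_zero (f : ℤ[X]) : zetaElt f 0 = 0 := by
  simp [zetaElt]

theorem zetaElt_succ (f : ℤ[X]) (i : ℕ) :
    zetaElt f (i + 1)
      = rootClass f * (zetaElt f i + (f.coeff (f.natDegree - i) : rootAlgebra f)) := by
  unfold zetaElt
  rw [Finset.sum_range_succ, mul_add, Finset.mul_sum]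
  congr 1
  · refine Finset.sum_congr rfl fun j hj => ?_
    have hj' := Finset.mem_range.1 hj
    rw [show i + 1 - j = (i - j) + 1 by omega, pow_succ]
    ring
  · simp [mul_comm]

theorem zetaElt_natDegree (f : ℤ[X]) :
    zetaElt f f.natDegree = -(f.coeff 0 : rootAlgebra f) := by
  have h : eval₂ (Int.castRingHom (rootAlgebra f)) (rootClass f) f = 0 := by
    have h1 := AdjoinRoot.eval₂_root (f.map (Int.castRingHom ℚ))
    rw [eval₂_map] at h1
    rw [← RingHom.eq_intCast' ((AdjoinRoot.of (f.map (Int.castRingHom ℚ))).comp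
      (Int.castRingHom ℚ))]
    exact h1
  rw [eval₂_eq_sum_range, ← Finset.sum_range_reflect, Finset.sum_range_succ] at h
  have h2 : zetaElt f f.natDegree
      = ∑ j ∈ Finset.range f.natDegree,
        (Int.castRingHom (rootAlgebra f)) (f.coeff (f.natDegree + 1 - 1 - j))
          * rootClass f ^ (f.natDegree + 1 - 1 - j) :=
    Finset.sum_congr rfl fun j _ => by rw [Nat.add_sub_cancel, eq_intCast]
  rw [← h2] at h
  rw [eq_neg_iff_add_eq_zero, ← h]
  simp

theorem intCast_mem_orderSpan (f : ℤ[X]) (m : ℤ) : (m : rootAlgebra f) ∈ orderSpan f := by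
  have h : (1 : rootAlgebra f) ∈ orderSpan f :=
    AddSubgroup.subset_closure (Set.mem_insert _ _)
  simpa using (orderSpan f).zsmul_mem h m

theorem intCast_mul_mem_orderSpan (f : ℤ[X]) (m : ℤ) {x : rootAlgebra f} (hx : x ∈ orderSpan f) :
    (m : rootAlgebra f) * x ∈ orderSpan f := by
  simpa using (orderSpan f).zsmul_mem hx m

theorem zetaElt_mem_orderSpan (f : ℤ[X]) {i : ℕ} (hi : i ≤ f.natDegree) :
    zetaElt f i ∈ orderSpan f := by
  rcases Nat.eq_zero_or_pos i with rfl | h0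
  · rw [zetaElt_zero]
    exact zero_mem _
  rcases hi.eq_or_lt with rfl | h1
  · rw [zetaElt_natDegree]
    exact neg_mem (intCast_mem_orderSpan f _)
  · exact AddSubgroup.subset_closure (Set.mem_insert_of_mem _ ⟨i, ⟨h0, h1⟩, rfl⟩)

theorem zetaElt_mul_mem_orderSpan (f : ℤ[X]) (i : ℕ) :
    ∀ j, i ≤ f.natDegree → j ≤ f.natDegree → zetaElt f i * zetaElt f j ∈ orderSpan f := by
  induction i with
  | zero =>
    intro j _ _
    rw [zetaElt_zero, zero_mul]
    exact zero_mem _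
  | succ i ih =>
    intro j hi hj
    rcases hj.eq_or_lt with rfl | h1
    · rw [zetaElt_natDegree, mul_neg, mul_comm]
      exact neg_mem (intCast_mul_mem_orderSpan f _ (zetaElt_mem_orderSpan f hi))
    · have key : zetaElt f (i + 1) * zetaElt f j
          = zetaElt f i * zetaElt f (j + 1)
            + (f.coeff (f.natDegree - i) : rootAlgebra f) * zetaElt f (j + 1)
            - (f.coeff (f.natDegree - j) : rootAlgebra f) * zetaElt f (i + 1) := by
        rw [zetaElt_succ, zetaElt_succ]
        ring
      rw [key]
      exact sub_mem (add_mem (ih _ (by omega) h1)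
        (intCast_mul_mem_orderSpan f _ (zetaElt_mem_orderSpan f h1)))
        (intCast_mul_mem_orderSpan f _ (zetaElt_mem_orderSpan f hi))

theorem mul_mem_orderSpan (f : ℤ[X]) {x y : rootAlgebra f} (hx : x ∈ orderSpan f)
    (hy : y ∈ orderSpan f) : x * y ∈ orderSpan f := by
  unfold orderSpan at hx hy
  induction hx using AddSubgroup.closure_induction with
  | zero => simp
  | add a b _ _ ha hb => rw [add_mul]; exact add_mem ha hb
  | neg a _ ha => rw [neg_mul]; exact neg_mem ha
  | mem a ha =>
    induction hy using AddSubgroup.closure_induction with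
    | zero => simp
    | add c d _ _ hc hd => rw [mul_add]; exact add_mem hc hd
    | neg c _ hc => rw [mul_neg]; exact neg_mem hc
    | mem c hc =>
      rcases ha with rfl | ⟨i, hi, rfl⟩
      · rw [one_mul]
        exact AddSubgroup.subset_closure hc
      · rcases hc with rfl | ⟨j, hj, rfl⟩
        · rw [mul_one]
          exact zetaElt_mem_orderSpan f hi.2.le
        · exact zetaElt_mul_mem_orderSpan f i j hi.2.le hj.2.le

/-- The invariant order `R_f`: the subring of `K_f` with `ℤ`-basis `1, ζ₁, …, ζ_{n-1}`. -/
def invariantOrder (f : ℤ[X]) : Subring (rootAlgebra f) where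
  toAddSubmonoid := (orderSpan f).toAddSubmonoid
  one_mem' := AddSubgroup.subset_closure (Set.mem_insert _ _)
  mul_mem' := mul_mem_orderSpan f
  neg_mem' := (orderSpan f).neg_mem

/-- The invariant ideal `I_f`: the fractional `R_f`-ideal in `K_f` generated by `1` and `α`. Its
powers are products of `R_f`-submodules of `K_f`. -/
def invariantIdeal (f : ℤ[X]) : Submodule (invariantOrder f) (rootAlgebra f) :=
  Submodule.span (invariantOrder f) {1, rootClass f}

/-- The `ℚ`-algebra isomorphism `Φ : K_f → K_g` maps the fractional ideal `I` onto `κ J` for some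
unit `κ` of `K_g`. -/
def MapsToMultiple {f g : ℤ[X]} (Φ : rootAlgebra f ≃ₐ[ℚ] rootAlgebra g)
    (I : Submodule (invariantOrder f) (rootAlgebra f))
    (J : Submodule (invariantOrder g) (rootAlgebra g)) : Prop :=
  ∃ κ : (rootAlgebra g)ˣ,
    Φ '' (I : Set (rootAlgebra f))
      = (fun x => (κ : rootAlgebra g) * x) '' (J : Set (rootAlgebra g))

/-- The fractional ideals `I` of `R_f` and `J` of `R_g` belong to the same ideal class under the ring
isomorphism `φ : R_f → R_g`: the extension `Φ : K_f → K_g` of `φ` to the `ℚ`-algebras generated by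
the two orders maps `I` onto `κ J` for some unit `κ` of `K_g`. -/
def SameIdealClassUnder {f g : ℤ[X]} (φ : invariantOrder f ≃+* invariantOrder g)
    (I : Submodule (invariantOrder f) (rootAlgebra f))
    (J : Submodule (invariantOrder g) (rootAlgebra g)) : Prop :=
  ∃ Φ : rootAlgebra f ≃ₐ[ℚ] rootAlgebra g,
    (∀ x : invariantOrder f, Φ (x : rootAlgebra f) = (φ x : rootAlgebra g)) ∧
      MapsToMultiple Φ I J

end

/-!
Let `v(x) = (1, x, …, x ^ (n - 1))`, let `r` and `s` list the complex zeros of `f` and `g`, and let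
`M_f = ℤ + ℤ α + ⋯ + ℤ α ^ (n - 1) = I_f ^ (n - 1)`. Everything is expressed through transitions
(`IsTransition`): matrices `P ∈ GL_n(ℤ)` with `v(sᵢ) P = cᵢ v(r_{σ i})` for a permutation `σ` and
nonzero factors `cᵢ`.

A transition with `g₀ ^ (n - 1) ∏ cᵢ = ± f₀ ^ (n - 1)` is a Hermite equivalence, as the linear factors
of `[f]` are the products of `v(rᵢ)` with the vector of variables. Conversely, for distinct zeros a
Hermite equivalence permutes the linear factors up to scalars, so it comes from such a transition
(`HermiteEquivalent.exists_isTransition`).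

Transitions are also the isomorphisms `Φ : K_f → K_g` with `Φ(M_f) = κ M_g`. Given `Φ`, comparison of
the `ℤ`-bases and evaluation at the zeros yields a transition whose `cᵢ` are the inverses of the
images of `κ` (`exists_isTransition_of_mapsToMultiple`). Given `P`, the first two columns of `P`
define elements of `K_g` whose quotient is the image of `α` (`IsTransition.exists_algEquiv`); both
sides are compared after embedding `K_g` into `ℂ ^ n`, so no Galois descent is needed.

The normalization of `∏ cᵢ` is a statement on indices. The order attached to a polynomial `a` with
zero `α` has determinant `a₀ ^ (n - 1)` with respect to the basis of powers of `α`. Hence if `Φ` maps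
the order of `a` onto the order of `b`, then `b₀ ^ (n - 1) ∏ cᵢ = ± a₀ ^ (n - 1)`
(`IsTransition.leadingCoeff_pow_eq`). For `a = f`, `b = g` this gives Hermite equivalence from an
isomorphism of the invariant orders. In the other direction, the order `O_f` of the primitive part of
`f` is the multiplier ring of `M_f` (`mem_orderLattice_primPart_iff`), so every `Φ` with
`Φ(M_f) = κ M_g` maps `O_f` onto `O_g`. The index relation for the primitive parts, compared with the
one for `f` and `g` which Hermite equivalence provides, shows that `f` and `g` have the same content
`c`. As `R_f = ℤ + c O_f`, it follows that `Φ(R_f) = R_g`.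

For monic polynomials `M_f = R_f`, and a ring isomorphism `R_f → R_g` extends to `K_f`.
A substitution in `GL₂(ℤ)` acts on the polynomials of degree less than `n` by a matrix in `GL_n(ℤ)`,
which is a transition between the zeros, distinct or not (`hermiteEquivalent_of_map_eq`).
-/

noncomputable section

open Matrix
open scoped Pointwise

/-! ### Complex zeros and the forms `[f]` -/

/-- The family `r` lists the complex zeros of `f`, with multiplicity. -/
def IsRootFamily {n : ℕ} (f : ℤ[X]) (r : Fin n → ℂ) : Prop :=
  f.map (Int.castRingHom ℂ) = C (f.leadingCoeff : ℂ) * ∏ i, (X - C (r i))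

theorem exists_isRootFamily {n : ℕ} {f : ℤ[X]} (hf : f.natDegree = n) :
    ∃ r : Fin n → ℂ, IsRootFamily f r := by
  set p := f.map (Int.castRingHom ℂ) with hp
  have hinj : Function.Injective (Int.castRingHom ℂ) := RingHom.injective_int _
  have hcard : p.roots.card = n := by
    rw [← hf, ← natDegree_map_eq_of_injective hinj f]
    exact (IsAlgClosed.splits p).natDegree_eq_card_roots.symm
  have hl : p.roots.toList.length = n := by simpa using hcard
  refine ⟨fun i => p.roots.toList.get (i.cast hl.symm), ?_⟩
  have h2 := (IsAlgClosed.splits p).eq_prod_roots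
  have h3 : ∀ s : List ℂ, ∀ h : s.length = n,
      ∏ i : Fin n, (X - C (s.get (i.cast h.symm))) = ((s : Multiset ℂ).map fun a => X - C a).prod := by
    rintro s rfl
    simp only [Fin.cast_eq_self, Multiset.map_coe, Multiset.prod_coe]
    exact Fin.prod_univ_fun_getElem s fun a => X - C a
  rw [IsRootFamily, h3 _ hl, Multiset.coe_toList, ← hp]
  rw [leadingCoeff_map_of_injective hinj] at h2
  simpa using h2

namespace IsRootFamily

variable {n : ℕ} {f : ℤ[X]} {r : Fin n → ℂ}

theorem roots_eq (h : IsRootFamily f r) (hf : f ≠ 0) :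
    (f.map (Int.castRingHom ℂ)).roots = Finset.univ.val.map r := by
  rw [h, roots_C_mul _ (by simpa using hf)]
  have := roots_multiset_prod_X_sub_C (Finset.univ.val.map r)
  rwa [Multiset.map_map] at this

theorem eval_eq_zero (h : IsRootFamily f r) (i : Fin n) :
    (f.map (Int.castRingHom ℂ)).eval (r i) = 0 := by
  rw [h, eval_mul, eval_prod, Finset.prod_eq_zero (Finset.mem_univ i) (by simp), mul_zero]

theorem mem_range_of_eval_eq_zero (h : IsRootFamily f r) (hf : f ≠ 0) {z : ℂ}
    (hz : (f.map (Int.castRingHom ℂ)).eval z = 0) : ∃ i, r i = z := by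
  rw [h, eval_mul, eval_prod, mul_eq_zero] at hz
  obtain ⟨i, -, hi⟩ := Finset.prod_eq_zero_iff.1 (hz.resolve_left (by simpa using hf))
  refine ⟨i, ?_⟩
  simp only [eval_sub, eval_X, eval_C] at hi
  exact (sub_eq_zero.1 hi).symm

theorem eval_hermiteForm (h : IsRootFamily f r) (hf : f ≠ 0) (x : Fin n → ℂ) :
    MvPolynomial.eval x (hermiteForm n f)
      = (f.leadingCoeff : ℂ) ^ (n - 1) * ∏ i, ∑ j : Fin n, r i ^ (j : ℕ) * x j.rev := by
  rw [hermiteForm, h.roots_eq hf, Multiset.map_map]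
  change MvPolynomial.eval x (_ * ∏ i, _) = _
  rw [map_mul, map_prod, MvPolynomial.eval_C]
  congr 1
  refine Finset.prod_congr rfl fun i _ => ?_
  simp only [Function.comp, map_sum, map_mul, MvPolynomial.eval_C, MvPolynomial.eval_X]
  rw [← Equiv.sum_comp Fin.revPerm]
  refine Finset.sum_congr rfl fun j _ => ?_
  simp only [Fin.revPerm_apply, Fin.val_rev]
  congr 2
  omega

theorem injective (h : IsRootFamily f r) (hn : 0 < n) (hf : f.natDegree = n)
    (hd : f.discr ≠ 0) : Function.Injective r := by
  set p := f.map (Int.castRingHom ℂ) with hp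
  have hinj : Function.Injective (Int.castRingHom ℂ) := RingHom.injective_int _
  have hf0 : f ≠ 0 := by rintro rfl; simp at hf; omega
  have h1 := resultant_deriv (f := f) (natDegree_pos_iff_degree_pos.1 (by omega))
  have h2 : resultant p (derivative p) f.natDegree (f.natDegree - 1) ≠ 0 := by
    rw [hp, derivative_map, resultant_map_map, h1]
    simpa using ⟨hf0, hd⟩
  have hpn : p.natDegree = f.natDegree := natDegree_map_eq_of_injective hinj f
  have h3 : (derivative p).natDegree = f.natDegree - 1 := by
    rw [natDegree_derivative, hpn]
  have hsep : p.Separable := by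
    by_contra hc
    apply h2
    rw [← h3, ← hpn]
    exact resultant_eq_zero_iff.2
      ⟨Or.inl (by simpa [hp, Polynomial.map_eq_zero_iff hinj] using hf0), hc⟩
  have hnd := nodup_roots hsep
  rw [h.roots_eq hf0] at hnd
  intro i j hij
  exact Multiset.inj_on_of_nodup_map hnd i (Finset.mem_univ_val i) j (Finset.mem_univ_val j) hij

end IsRootFamily

theorem eval_linSubst {ι R : Type*} [Fintype ι] [CommRing R] (A : Matrix ι ι R)
    (P : MvPolynomial ι R) (x : ι → R) :
    MvPolynomial.eval x (linSubst A P) = MvPolynomial.eval (A *ᵥ x) P := by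
  rw [linSubst, ← MvPolynomial.coe_aeval_eq_eval, ← MvPolynomial.coe_aeval_eq_eval]
  simp only [RingHom.coe_coe, MvPolynomial.aeval_bind₁]
  congr 2
  ext i
  simp [Matrix.mulVec, dotProduct]

/-- Hermite equivalence, expressed through the values of the two forms, with the variables listed
in the reverse order so that the linear factors become the rows of Vandermonde matrices. -/
theorem hermiteEquivalent_iff {n : ℕ} {f g : ℤ[X]} {r s : Fin n → ℂ} (hr : IsRootFamily f r)
    (hs : IsRootFamily g s) (hf : f ≠ 0) (hg : g ≠ 0) :
    HermiteEquivalent n f g ↔ ∃ P Q : Matrix (Fin n) (Fin n) ℤ, P * Q = 1 ∧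
      ∃ ε : ℂ, (ε = 1 ∨ ε = -1) ∧ ∀ x : Fin n → ℂ,
        (g.leadingCoeff : ℂ) ^ (n - 1) *
            ∏ i, ((vandermonde s * P.map (Int.cast : ℤ → ℂ)) *ᵥ x) i
          = ε * ((f.leadingCoeff : ℂ) ^ (n - 1) * ∏ i, (vandermonde r *ᵥ x) i) := by
  have key : ∀ (U : Matrix (Fin n) (Fin n) ℤ) (x : Fin n → ℂ),
      MvPolynomial.eval x (linSubst (U.map (Int.cast : ℤ → ℂ)) (hermiteForm n g))
        = (g.leadingCoeff : ℂ) ^ (n - 1) *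
            ∏ i, ((vandermonde s * (U.submatrix Fin.rev Fin.rev).map (Int.cast : ℤ → ℂ)) *ᵥ
              (x ∘ Fin.rev)) i := by
    intro U x
    rw [eval_linSubst, hs.eval_hermiteForm hg]
    congr 1
    refine Finset.prod_congr rfl fun i _ => ?_
    rw [← Matrix.mulVec_mulVec]
    simp only [Matrix.mulVec, dotProduct, vandermonde_apply, Matrix.map_apply,
      Matrix.submatrix_apply, Function.comp]
    refine Finset.sum_congr rfl fun j _ => ?_
    congr 1
    exact (Equiv.sum_comp Fin.revPerm fun k => ((U j.rev k : ℤ) : ℂ) * x k).symm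
  have key2 : ∀ x : Fin n → ℂ, MvPolynomial.eval x (hermiteForm n f)
      = (f.leadingCoeff : ℂ) ^ (n - 1) * ∏ i, (vandermonde r *ᵥ (x ∘ Fin.rev)) i := by
    intro x
    rw [hr.eval_hermiteForm hf]
    rfl
  have hrev : ∀ x : Fin n → ℂ, (x ∘ Fin.rev) ∘ Fin.rev = x := by
    intro x; ext i; simp
  constructor
  · rintro ⟨U, hU⟩
    refine ⟨(U : Matrix (Fin n) (Fin n) ℤ).submatrix Fin.rev Fin.rev,
      ((U⁻¹ : GL (Fin n) ℤ) : Matrix (Fin n) (Fin n) ℤ).submatrix Fin.rev Fin.rev, ?_, ?_⟩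
    · have := Matrix.submatrix_mul_equiv (U : Matrix (Fin n) (Fin n) ℤ)
        ((U⁻¹ : GL (Fin n) ℤ) : Matrix (Fin n) (Fin n) ℤ) Fin.rev Fin.revPerm Fin.rev
      rw [← Units.val_mul, mul_inv_cancel, Units.val_one] at this
      refine this.trans ?_
      exact Matrix.submatrix_one _ Fin.rev_injective
    · rcases hU with hU | hU
      · refine ⟨1, Or.inl rfl, fun x => ?_⟩
        have := congrArg (MvPolynomial.eval (x ∘ Fin.rev)) hU
        rw [key, key2, hrev] at this
        rw [this, one_mul]
      · refine ⟨-1, Or.inr rfl, fun x => ?_⟩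
        have := congrArg (MvPolynomial.eval (x ∘ Fin.rev)) hU
        rw [map_neg, key, key2, hrev] at this
        rw [this, neg_one_mul]
  · rintro ⟨P, Q, hPQ, ε, hε, h⟩
    have hPQ' : P.submatrix Fin.rev Fin.rev * Q.submatrix Fin.rev Fin.rev = 1 := by
      refine (Matrix.submatrix_mul_equiv P Q Fin.rev Fin.revPerm Fin.rev).trans ?_
      rw [hPQ]
      exact Matrix.submatrix_one _ Fin.rev_injective
    refine ⟨⟨P.submatrix Fin.rev Fin.rev, Q.submatrix Fin.rev Fin.rev, hPQ',
      mul_eq_one_comm.1 hPQ'⟩, ?_⟩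
    have hP : (P.submatrix Fin.rev Fin.rev).submatrix Fin.rev Fin.rev = P := by
      ext i j; simp
    rcases hε with rfl | rfl
    · refine Or.inl (MvPolynomial.funext fun x => ?_)
      rw [key, key2, hP, h, one_mul]
    · refine Or.inr (MvPolynomial.funext fun x => ?_)
      rw [map_neg, key, key2, hP, h, neg_one_mul]

/-! ### Transition matrices between the zeros -/

/-- The integer matrix `P` carries the rows `(1, sᵢ, …, sᵢ ^ (n - 1))` to multiples of the rows
`(1, r_{σ i}, …, r_{σ i} ^ (n - 1))`, with factors `cᵢ`. -/
def IsTransition {n : ℕ} (r s : Fin n → ℂ) (P : Matrix (Fin n) (Fin n) ℤ) (σ : Equiv.Perm (Fin n))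
    (c : Fin n → ℂ) : Prop :=
  ∀ i j : Fin n, (vandermonde s * P.map (Int.cast : ℤ → ℂ)) i j = c i * r (σ i) ^ (j : ℕ)

namespace IsTransition

variable {n : ℕ} {r s : Fin n → ℂ} {P Q : Matrix (Fin n) (Fin n) ℤ} {σ : Equiv.Perm (Fin n)}
  {c : Fin n → ℂ}

theorem mulVec_apply (h : IsTransition r s P σ c) (x : Fin n → ℂ) (i : Fin n) :
    ((vandermonde s * P.map (Int.cast : ℤ → ℂ)) *ᵥ x) i = c i * (vandermonde r *ᵥ x) (σ i) := by
  simp only [Matrix.mulVec, dotProduct, h i, Finset.mul_sum, vandermonde_apply, mul_assoc]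

theorem sum_eq (h : IsTransition r s P σ c) (i j : Fin n) :
    ∑ k : Fin n, (P k j : ℂ) * s i ^ (k : ℕ) = c i * r (σ i) ^ (j : ℕ) := by
  rw [← h i j, Matrix.mul_apply]
  exact Finset.sum_congr rfl fun k _ => by simp [mul_comm]

theorem vandermonde_mul (h : IsTransition r s P σ c) :
    vandermonde s * P.map (Int.cast : ℤ → ℂ)
      = diagonal c * (vandermonde r).submatrix σ id := by
  ext i j
  rw [h, diagonal_mul]
  rfl

theorem hermiteEquivalent (h : IsTransition r s P σ c) {f g : ℤ[X]} (hr : IsRootFamily f r)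
    (hs : IsRootFamily g s) (hf : f ≠ 0) (hg : g ≠ 0) (hPQ : P * Q = 1) {ε : ℂ}
    (hε : ε = 1 ∨ ε = -1)
    (hc : (g.leadingCoeff : ℂ) ^ (n - 1) * ∏ i, c i = ε * (f.leadingCoeff : ℂ) ^ (n - 1)) :
    HermiteEquivalent n f g := by
  refine (hermiteEquivalent_iff hr hs hf hg).2 ⟨P, Q, hPQ, ε, hε, fun x => ?_⟩
  simp only [h.mulVec_apply, Finset.prod_mul_distrib]
  rw [Equiv.prod_comp σ (vandermonde r *ᵥ x), ← mul_assoc, hc, mul_assoc]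

end IsTransition

theorem map_intCast_mul {n : ℕ} (P Q : Matrix (Fin n) (Fin n) ℤ) :
    (P * Q).map (Int.cast : ℤ → ℂ) = P.map (Int.cast : ℤ → ℂ) * Q.map (Int.cast : ℤ → ℂ) :=
  Matrix.map_mul (f := Int.castRingHom ℂ)

theorem map_intCast_one {n : ℕ} :
    (1 : Matrix (Fin n) (Fin n) ℤ).map (Int.cast : ℤ → ℂ) = 1 :=
  Matrix.map_one _ Int.cast_zero Int.cast_one

theorem vandermonde_mulVec_single_zero {n : ℕ} [NeZero n] (r : Fin n → ℂ) (i : Fin n) :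
    (vandermonde r *ᵥ Pi.single 0 1) i = 1 := by
  simp [vandermonde_apply]

/-- A linear form on whose kernel the product of the forms `∑ rᵢ ^ j xⱼ` vanishes is proportional to
one of them: its kernel is covered by finitely many hyperplanes, hence contained in one of them. This
replaces unique factorization in the ring of polynomials. The value at the basis vector of index `0`
is the factor, as the forms `∑ rᵢ ^ j xⱼ` take the value `1` there. -/
theorem exists_eq_mul_of_forall_eq_zero {n : ℕ} [NeZero n] (r : Fin n → ℂ)
    (L : (Fin n → ℂ) →ₗ[ℂ] ℂ)
    (h : ∀ x, L x = 0 → ∏ i, (vandermonde r *ᵥ x) i = 0) :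
    ∃ k, ∀ x, L x = L (Pi.single 0 1) * (vandermonde r *ᵥ x) k := by
  let R : Fin n → (Fin n → ℂ) →ₗ[ℂ] ℂ := fun k => (LinearMap.proj k).comp (vandermonde r).mulVecLin
  have hR : ∀ k x, R k x = (vandermonde r *ᵥ x) k := fun k x => rfl
  have hcov : ⋃ k, (((LinearMap.ker (R k)).comap (LinearMap.ker L).subtype :
      Submodule ℂ (LinearMap.ker L)) : Set (LinearMap.ker L)) = Set.univ := by
    refine Set.eq_univ_of_forall fun x => ?_
    obtain ⟨k, -, hk⟩ := Finset.prod_eq_zero_iff.1 (h x x.2)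
    exact Set.mem_iUnion.2 ⟨k, hk⟩
  obtain ⟨k, hk⟩ := Subspace.exists_eq_top_of_iUnion_eq_univ hcov
  have hker : ∀ x, L x = 0 → (vandermonde r *ᵥ x) k = 0 := by
    intro x hx
    have : (⟨x, hx⟩ : LinearMap.ker L) ∈
        (LinearMap.ker (R k)).comap (LinearMap.ker L).subtype := by rw [hk]; trivial
    exact this
  refine ⟨k, fun x => ?_⟩
  set e : Fin n → ℂ := Pi.single 0 1
  have he : R k e = 1 := vandermonde_mulVec_single_zero r k
  have hLe : L e ≠ 0 := by
    intro h0
    have := hker e h0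
    rw [← hR, he] at this
    exact one_ne_zero this
  have h1 : R k (x - (L x / L e) • e) = 0 := hker _ (by simp [hLe])
  rw [map_sub, map_smul, he, smul_eq_mul, mul_one, sub_eq_zero] at h1
  rw [← hR, h1]
  field_simp

/-- A Hermite equivalence permutes the linear factors of the two forms up to scalars. -/
theorem HermiteEquivalent.exists_isTransition {n : ℕ} (hn : 2 ≤ n) {f g : ℤ[X]} {r s : Fin n → ℂ}
    (hr : IsRootFamily f r) (hs : IsRootFamily g s) (hsinj : Function.Injective s)
    (hf : f ≠ 0) (hg : g ≠ 0) (h : HermiteEquivalent n f g) :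
    ∃ P Q : Matrix (Fin n) (Fin n) ℤ, P * Q = 1 ∧ ∃ σ c, IsTransition r s P σ c ∧
      (∀ i, c i ≠ 0) ∧ ∃ ε : ℂ, (ε = 1 ∨ ε = -1) ∧
        (g.leadingCoeff : ℂ) ^ (n - 1) * ∏ i, c i = ε * (f.leadingCoeff : ℂ) ^ (n - 1) := by
  obtain ⟨P, Q, hPQ, ε, hε, h⟩ := (hermiteEquivalent_iff hr hs hf hg).1 h
  have : NeZero n := ⟨by omega⟩
  set A := vandermonde s * P.map (Int.cast : ℤ → ℂ) with hA
  let L : Fin n → (Fin n → ℂ) →ₗ[ℂ] ℂ := fun k => (LinearMap.proj k).comp A.mulVecLin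
  have hL : ∀ i x, L i x = (A *ᵥ x) i := fun _ _ => rfl
  have hε0 : ε ≠ 0 := by rcases hε with rfl | rfl <;> norm_num
  have hlf : (f.leadingCoeff : ℂ) ≠ 0 := by simpa using hf
  have hex : ∀ i, ∃ k, ∀ x, L i x = L i (Pi.single 0 1) * (vandermonde r *ᵥ x) k := by
    intro i
    refine exists_eq_mul_of_forall_eq_zero r (L i) fun x hx => ?_
    have h1 := h x
    rw [Finset.prod_eq_zero (Finset.mem_univ i) hx, mul_zero] at h1
    simpa [hε0, hlf] using h1.symm
  choose σ hσ using hex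
  set c : Fin n → ℂ := fun i => L i (Pi.single 0 1) with hcdef
  have hprod : (g.leadingCoeff : ℂ) ^ (n - 1) * ∏ i, c i
      = ε * (f.leadingCoeff : ℂ) ^ (n - 1) := by
    have h1 := h (Pi.single 0 1)
    simp only [vandermonde_mulVec_single_zero, Finset.prod_const_one, mul_one] at h1
    exact h1
  have hc0 : ∀ i, c i ≠ 0 := by
    intro i hi
    rw [Finset.prod_eq_zero (Finset.mem_univ i) hi, mul_zero] at hprod
    simp [hε0, hlf] at hprod
  have hrow : ∀ i j : Fin n, A i j = c i * r (σ i) ^ (j : ℕ) := by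
    intro i j
    have h1 := hσ i (Pi.single j 1)
    simpa [hcdef, hL, vandermonde_apply] using h1
  have hPQ' : P.map (Int.cast : ℤ → ℂ) * Q.map (Int.cast : ℤ → ℂ) = 1 := by
    rw [← map_intCast_mul, hPQ, map_intCast_one]
  have hAQ : A * Q.map (Int.cast : ℤ → ℂ) = vandermonde s := by
    rw [hA, Matrix.mul_assoc, hPQ', Matrix.mul_one]
  have hσinj : Function.Injective σ := by
    intro i i' hii
    have h1 : ∀ j, A i j = c i / c i' * A i' j := by
      intro j
      rw [hrow, hrow, hii]
      field_simp [hc0 i']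
    have h2 : ∀ j, vandermonde s i j = c i / c i' * vandermonde s i' j := by
      intro j
      rw [← hAQ, Matrix.mul_apply, Matrix.mul_apply, Finset.mul_sum]
      exact Finset.sum_congr rfl fun k _ => by rw [h1]; ring
    have h3 := h2 0
    have h4 := h2 ⟨1, by omega⟩
    simp only [vandermonde_apply, Fin.val_zero, pow_zero, mul_one] at h3
    simp only [vandermonde_apply, pow_one, ← h3, one_mul] at h4
    exact hsinj h4
  exact ⟨P, Q, hPQ, Equiv.ofBijective σ (Finite.injective_iff_bijective.1 hσinj), c,
    fun i j => hrow i j, hc0, ε, hε, hprod⟩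

/-- Integer matrices which express two bases of `ℂ ^ n` in terms of each other are inverse to each
other. -/
theorem mul_eq_one_of_basis_change {n : ℕ} {A B : Matrix (Fin n) (Fin n) ℂ} (hA : A.det ≠ 0)
    {P Q : Matrix (Fin n) (Fin n) ℤ} (hP : B = A * P.map (Int.cast : ℤ → ℂ))
    (hQ : A = B * Q.map (Int.cast : ℤ → ℂ)) : P * Q = 1 := by
  have h1 : A * (P.map (Int.cast : ℤ → ℂ) * Q.map (Int.cast : ℤ → ℂ)) = A * 1 := by
    rw [← Matrix.mul_assoc, ← hP, ← hQ, Matrix.mul_one]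
  have hu : IsUnit A := (Matrix.isUnit_iff_isUnit_det A).2 (isUnit_iff_ne_zero.2 hA)
  have h2 := hu.mul_left_cancel h1
  rw [← map_intCast_mul, ← map_intCast_one] at h2
  exact Matrix.map_injective Int.cast_injective h2

theorem det_intCast_sq {n : ℕ} {P Q : Matrix (Fin n) (Fin n) ℤ} (h : P * Q = 1) :
    (P.map (Int.cast : ℤ → ℂ)).det ^ 2 = 1 := by
  have h1 : IsUnit P.det := (Matrix.isUnit_iff_isUnit_det P).1 (IsUnit.of_mul_eq_one Q h)
  have h2 : (P.map (Int.cast : ℤ → ℂ)).det = (P.det : ℂ) := ((Int.castRingHom ℂ).map_det P).symm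
  rw [h2]
  rcases Int.isUnit_iff.1 h1 with h | h <;> simp [h]

theorem det_submatrix_perm_sq {n : ℕ} (A : Matrix (Fin n) (Fin n) ℂ)
    (σ : Equiv.Perm (Fin n)) : (A.submatrix σ id).det ^ 2 = A.det ^ 2 := by
  rw [Matrix.det_permute]
  rcases Int.units_eq_one_or (Equiv.Perm.sign σ) with h | h <;> simp [h]

/-- Squares absorb the signs of the permutation and of the unimodular matrix. -/
theorem IsTransition.det_vandermonde_sq {n : ℕ} {r s : Fin n → ℂ}
    {P Q : Matrix (Fin n) (Fin n) ℤ} {σ : Equiv.Perm (Fin n)} {c : Fin n → ℂ}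
    (h : IsTransition r s P σ c) (hPQ : P * Q = 1) :
    (vandermonde s).det ^ 2 = (∏ i, c i) ^ 2 * (vandermonde r).det ^ 2 := by
  have h1 := congrArg (fun M => M.det ^ 2) h.vandermonde_mul
  simpa only [det_mul, det_diagonal, mul_pow, det_intCast_sq hPQ, det_submatrix_perm_sq,
    mul_one] using h1

/-! ### Equivalence under `GL₂(ℤ)` -/

/-- The matrix of the substitution `p ↦ (c X + d) ^ (n - 1) p ((a X + b) / (c X + d))` on the
polynomials of degree less than `n`, in the basis `1, X, …, X ^ (n - 1)`. -/
def substMatrix (n : ℕ) (a b c d : ℤ) : Matrix (Fin n) (Fin n) ℤ :=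
  Matrix.of fun k j =>
    ((C a * X + C b) ^ (j : ℕ) * (C c * X + C d) ^ (n - 1 - (j : ℕ)) : ℤ[X]).coeff k

theorem vandermonde_mul_substMatrix {n : ℕ} (a b c d : ℤ) (s : Fin n → ℂ) (i j : Fin n) :
    (vandermonde s * (substMatrix n a b c d).map (Int.cast : ℤ → ℂ)) i j
      = (a * s i + b) ^ (j : ℕ) * (c * s i + d) ^ (n - 1 - (j : ℕ)) := by
  set p : ℤ[X] := (C a * X + C b) ^ (j : ℕ) * (C c * X + C d) ^ (n - 1 - (j : ℕ)) with hp
  have hdeg : p.natDegree < n := by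
    have h1 : p.natDegree ≤ j * 1 + (n - 1 - j) * 1 :=
      natDegree_mul_le_of_le
        (natDegree_pow_le_of_le _ natDegree_linear_le)
        (natDegree_pow_le_of_le _ natDegree_linear_le)
    have := j.2
    omega
  have h2 : aeval (s i) p = (a * s i + b) ^ (j : ℕ) * (c * s i + d) ^ (n - 1 - (j : ℕ)) := by
    simp [hp]
  rw [← h2, aeval_eq_sum_range' hdeg, ← Fin.sum_univ_eq_sum_range fun k => p.coeff k • s i ^ k,
    Matrix.mul_apply]
  refine Finset.sum_congr rfl fun k _ => ?_
  have h3 : substMatrix n a b c d k j = p.coeff k := rfl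
  rw [Matrix.map_apply, h3, vandermonde_apply, zsmul_eq_mul, mul_comm]

theorem isTransition_substMatrix {n : ℕ} {a b c d : ℤ} {r s : Fin n → ℂ}
    (h : ∀ i, a * s i + b = r i * (c * s i + d)) :
    IsTransition r s (substMatrix n a b c d) 1 fun i => (c * s i + d) ^ (n - 1) := by
  intro i j
  rw [vandermonde_mul_substMatrix, h, mul_pow, mul_assoc, ← pow_add, mul_comm]
  congr 2
  have := j.2
  omega

theorem substMatrix_mul {n : ℕ} {a b c d δ : ℤ} (hδ : a * d - b * c = δ) (hδ2 : δ * δ = 1) :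
    substMatrix n a b c d * substMatrix n (δ * d) (-(δ * b)) (-(δ * c)) (δ * a) = 1 := by
  have hδ' : (a * d - b * c : ℂ) = δ := by exact_mod_cast hδ
  have hδ2' : (δ * δ : ℂ) = 1 := by exact_mod_cast hδ2
  -- distinct sample points at which the denominator does not vanish
  have hinf : {z : ℂ | (c * z + d : ℂ) ≠ 0}.Infinite := by
    have hfin : {z : ℂ | (c * z + d : ℂ) = 0}.Finite := by
      by_cases hc : c = 0
      · have hd : (d : ℂ) ≠ 0 := by
          rintro hd
          have : d = 0 := by exact_mod_cast hd
          subst hc this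
          simp at hδ
          simp [← hδ] at hδ2
        simp [hc, hd]
      · refine (Set.finite_singleton (-(d : ℂ) / c)).subset fun z hz => ?_
        have hc' : (c : ℂ) ≠ 0 := by exact_mod_cast hc
        have hz' : (c * z + d : ℂ) = 0 := hz
        rw [Set.mem_singleton_iff, eq_div_iff hc']
        linear_combination hz'
    exact hfin.infinite_compl
  let s : Fin n → ℂ := fun i => hinf.natEmbedding _ i
  have hs : ∀ i, (c * s i + d : ℂ) ≠ 0 := fun i => (hinf.natEmbedding _ (i : ℕ)).2
  have hsinj : Function.Injective s := fun i j hij =>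
    Fin.ext ((hinf.natEmbedding _).injective (Subtype.ext hij))
  let r : Fin n → ℂ := fun i => (a * s i + b) / (c * s i + d)
  have hrs : ∀ i, r i * (c * s i + d) = a * s i + b := fun i => div_mul_cancel₀ _ (hs i)
  have h1 : IsTransition r s (substMatrix n a b c d) 1 fun i => (c * s i + d) ^ (n - 1) :=
    isTransition_substMatrix fun i => (hrs i).symm
  have h2 : IsTransition s r (substMatrix n (δ * d) (-(δ * b)) (-(δ * c)) (δ * a)) 1
      fun i => ((-(δ * c) : ℤ) * r i + (δ * a : ℤ)) ^ (n - 1) := by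
    refine isTransition_substMatrix fun i => ?_
    push_cast
    linear_combination (δ : ℂ) * hrs i
  have h3 : ∀ i, (c * s i + d : ℂ) * ((-(δ * c) : ℤ) * r i + (δ * a : ℤ)) = 1 := by
    intro i
    push_cast
    linear_combination (-(δ : ℂ) * c) * hrs i + (δ : ℂ) * hδ' + hδ2'
  have h4 : vandermonde s * ((substMatrix n a b c d *
      substMatrix n (δ * d) (-(δ * b)) (-(δ * c)) (δ * a)).map (Int.cast : ℤ → ℂ))
      = vandermonde s * 1 := by
    rw [map_intCast_mul, ← Matrix.mul_assoc, h1.vandermonde_mul]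
    change _ * vandermonde r * _ = _
    rw [Matrix.mul_assoc, h2.vandermonde_mul]
    change _ * (_ * vandermonde s) = _
    rw [← Matrix.mul_assoc, diagonal_mul_diagonal]
    simp only [← mul_pow, h3, one_pow, diagonal_one, Matrix.one_mul, Matrix.mul_one]
  have hu : IsUnit (vandermonde s) := (Matrix.isUnit_iff_isUnit_det _).2
    (isUnit_iff_ne_zero.2 (det_vandermonde_ne_zero_iff.2 hsinj))
  have h5 := hu.mul_left_cancel h4
  rw [← map_intCast_one] at h5
  exact Matrix.map_injective Int.cast_injective h5

/-- If the zeros of `g` are the images of those of `f` under an element of `GL₂(ℤ)` acting by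
fractional linear transformations, then `f` and `g` are Hermite equivalent. -/
theorem hermiteEquivalent_of_map_eq {n : ℕ} {f g : ℤ[X]} (hgn : g.natDegree = n)
    (hf : f ≠ 0) (hg : g ≠ 0) {r : Fin n → ℂ} (hr : IsRootFamily f r)
    {a b c d δ : ℤ} (hδ : a * d - b * c = δ) (hδ2 : δ * δ = 1) {ε : ℂ} (hε : ε * ε = 1)
    (h : g.map (Int.castRingHom ℂ)
      = C (ε * f.leadingCoeff) * ∏ i, (C (a - r i * c) * X + C (b - r i * d))) :
    HermiteEquivalent n f g := by
  have hδ' : (a * d - b * c : ℂ) = δ := by exact_mod_cast hδ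
  have hδ2' : (δ * δ : ℂ) = 1 := by exact_mod_cast hδ2
  have hinj : Function.Injective (Int.castRingHom ℂ) := RingHom.injective_int _
  have hne : ∀ i, (a - r i * c : ℂ) ≠ 0 := by
    intro i hi
    have h1 : (g.map (Int.castRingHom ℂ)).natDegree
        ≤ ∑ i, (C (a - r i * c : ℂ) * X + C (b - r i * d : ℂ)).natDegree := by
      rw [h]
      exact (natDegree_C_mul_le _ _).trans (natDegree_prod_le _ _)
    have h2 : ∑ i, (C (a - r i * c : ℂ) * X + C (b - r i * d : ℂ)).natDegree
        < ∑ _i : Fin n, 1 := by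
      refine Finset.sum_lt_sum (fun j _ => natDegree_linear_le) ⟨i, Finset.mem_univ i, ?_⟩
      simp [hi, -map_sub]
    rw [natDegree_map_eq_of_injective hinj, hgn] at h1
    rw [Finset.sum_const, Finset.card_univ, Fintype.card_fin, smul_eq_mul, mul_one] at h2
    omega
  let s : Fin n → ℂ := fun i => (r i * d - b) / (a - r i * c)
  have hs : ∀ i, s i * (a - r i * c) = r i * d - b := fun i => div_mul_cancel₀ _ (hne i)
  have h1 : g.map (Int.castRingHom ℂ)
      = C (ε * f.leadingCoeff * ∏ i, (a - r i * c)) * ∏ i, (X - C (s i)) := by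
    rw [h, map_mul C _ (∏ i, (a - r i * c : ℂ)), mul_assoc, map_prod, ← Finset.prod_mul_distrib]
    congr 1
    refine Finset.prod_congr rfl fun i _ => ?_
    rw [mul_sub, ← C_mul, mul_comm (a - r i * c : ℂ), hs, ← neg_sub (b : ℂ), C_neg, sub_neg_eq_add]
  have h2 : (g.leadingCoeff : ℂ) = ε * f.leadingCoeff * ∏ i, (a - r i * c) := by
    have h3 := congrArg leadingCoeff h1
    rw [leadingCoeff_map_of_injective hinj, leadingCoeff_mul, leadingCoeff_C,
      (monic_prod_of_monic _ _ fun i _ => monic_X_sub_C (s i)).leadingCoeff, mul_one] at h3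
    exact h3
  have hgs : IsRootFamily g s := by rw [IsRootFamily, h2, h1]
  refine (isTransition_substMatrix (n := n) (a := a) (b := b) (c := c) (d := d) (r := r) (s := s)
    fun i => ?_).hermiteEquivalent hr hgs hf hg (substMatrix_mul hδ hδ2)
    (ε := (ε * δ ^ n) ^ (n - 1)) (mul_self_eq_one_iff.1 ?_) ?_
  · linear_combination hs i
  · rw [← mul_pow, mul_mul_mul_comm, hε, ← mul_pow, hδ2', one_pow, mul_one, one_pow]
  · have h3 : ∀ i, (a - r i * c : ℂ) * (c * s i + d) = δ := fun i => by
      linear_combination (c : ℂ) * hs i + hδ'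
    rw [Finset.prod_pow, ← mul_pow, ← mul_pow, h2, mul_assoc _ (∏ i, (a - r i * c : ℂ)),
      ← Finset.prod_mul_distrib]
    simp only [h3, Finset.prod_const, Finset.card_univ, Fintype.card_fin]
    ring

theorem IsRootFamily.aeval_homogenize {n : ℕ} {f : ℤ[X]} {r : Fin n → ℂ} (hr : IsRootFamily f r)
    (x : Fin 2 → ℂ) :
    MvPolynomial.aeval x (f.homogenize n) = f.leadingCoeff * ∏ i, (x 0 - r i * x 1) := by
  have h1 : MvPolynomial.aeval x (f.homogenize n)
      = MvPolynomial.eval x ((f.map (Int.castRingHom ℂ)).homogenize n) := by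
    rw [homogenize_map, MvPolynomial.eval_map]
    rfl
  have h2 := homogenize_finsetProd (s := Finset.univ) (p := fun i => X - C (r i))
    (n := fun _ : Fin n => 1) fun i _ => natDegree_X_sub_C_le (r i)
  simp only [Finset.sum_const, Finset.card_univ, Fintype.card_fin, smul_eq_mul, mul_one] at h2
  rw [h1, hr, homogenize_C_mul, h2]
  simp

theorem GL2Equivalent.hermiteEquivalent {n : ℕ} {f g : ℤ[X]} (hn : 2 ≤ n) (hfn : f.natDegree = n)
    (hgn : g.natDegree = n) (h : GL2Equivalent n f g) : HermiteEquivalent n f g := by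
  have hf : f ≠ 0 := by rintro rfl; simp at hfn; omega
  have hg : g ≠ 0 := by rintro rfl; simp at hgn; omega
  obtain ⟨γ, hγ⟩ := h
  obtain ⟨r, hr⟩ := exists_isRootFamily hfn
  have hdet := Int.isUnit_iff.1 ((Matrix.isUnit_iff_isUnit_det _).1 γ.isUnit)
  rw [det_fin_two] at hdet
  obtain ⟨ε, hε, hγ'⟩ : ∃ ε : ℤ, ε * ε = 1 ∧
      g.homogenize n = MvPolynomial.C ε * linSubst (γ : Matrix (Fin 2) (Fin 2) ℤ)
        (f.homogenize n) := by
    rcases hγ with h | h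
    · exact ⟨1, by norm_num, by simpa using h⟩
    · exact ⟨-1, by norm_num, by simpa using h⟩
  refine hermiteEquivalent_of_map_eq hgn hf hg hr rfl
    (mul_self_eq_one_iff.2 hdet) (ε := ε) (by exact_mod_cast hε) (Polynomial.funext fun x => ?_)
  have h1 := congrArg (MvPolynomial.aeval ![x, 1]) hγ'
  rw [aeval_homogenize_of_eq_one hgn.le _ (by simp), map_mul, linSubst,
    MvPolynomial.aeval_bind₁, hr.aeval_homogenize] at h1
  rw [eval_map, ← RingHom.eq_intCast' (algebraMap ℤ ℂ), ← aeval_def]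
  simp only [cons_val_zero] at h1
  rw [h1]
  simp only [eval_mul, eval_C, eval_prod, eval_add, eval_X, map_mul, MvPolynomial.aeval_X,
    Fin.sum_univ_two, map_add, MvPolynomial.aeval_C, cons_val_zero, cons_val_one]
  simp only [algebraMap_int_eq, eq_intCast, mul_assoc]
  congr 2
  exact Finset.prod_congr rfl fun i _ => by ring

theorem ZEquivalent.hermiteEquivalent {n : ℕ} {f g : ℤ[X]} (hn : 2 ≤ n) (hfn : f.natDegree = n)
    (hgn : g.natDegree = n) (h : ZEquivalent n f g) : HermiteEquivalent n f g := by
  have hf : f ≠ 0 := by rintro rfl; simp at hfn; omega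
  have hg : g ≠ 0 := by rintro rfl; simp at hgn; omega
  obtain ⟨ε, a, rfl⟩ := h
  obtain ⟨r, hr⟩ := exists_isRootFamily hfn
  have hε : (ε : ℤ) * ε = 1 := Int.units_coe_mul_self ε
  refine hermiteEquivalent_of_map_eq (a := ε) (b := a) (c := 0) (d := 1) (δ := ε)
    (ε := ((ε : ℤ) : ℂ) ^ n) hgn hf hg hr (by ring) hε ?_ ?_
  · rw [← mul_pow]
    have : (((ε : ℤ) : ℂ) * ((ε : ℤ) : ℂ)) = 1 := by exact_mod_cast hε
    rw [this, one_pow]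
  · rw [Polynomial.map_mul, Polynomial.map_comp, hr, mul_comp, prod_comp]
    simp [mul_assoc, add_sub_assoc]

/-! ### The invariant order and the powers of the invariant ideal -/

/-- The polynomial whose value at `α` is the basis element of index `j` of the order attached to
`a = a₀ X ^ n + ⋯ + aₙ`: it is `1` for `j = 0` and `a₀ X ^ j + a₁ X ^ (j - 1) + ⋯ + a_{j-1} X` for
`j ≥ 1`. -/
def orderPoly (a : ℤ[X]) (j : ℕ) : ℤ[X] :=
  if j = 0 then 1 else ∑ i ∈ Finset.range j, C (a.coeff (a.natDegree - i)) * X ^ (j - i)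

theorem orderPoly_zero (a : ℤ[X]) : orderPoly a 0 = 1 := if_pos rfl

theorem coeff_orderPoly (a : ℤ[X]) {j : ℕ} (hj : j ≠ 0) (hja : j ≤ a.natDegree) (k : ℕ) :
    (orderPoly a j).coeff k
      = if 1 ≤ k ∧ k ≤ j then a.coeff (a.natDegree - j + k) else 0 := by
  rw [orderPoly, if_neg hj, finsetSum_coeff]
  simp only [coeff_C_mul_X_pow]
  split_ifs with h
  · rw [Finset.sum_eq_single (j - k)]
    · rw [if_pos (by omega)]
      congr 1
      omega
    · intro i hi hne
      have := Finset.mem_range.1 hi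
      rw [if_neg (by omega)]
    · intro hk
      simp only [Finset.mem_range, not_lt] at hk
      omega
  · refine Finset.sum_eq_zero fun i hi => ?_
    have := Finset.mem_range.1 hi
    rw [if_neg (by omega)]

theorem coeff_orderPoly_of_lt (a : ℤ[X]) {j : ℕ} (hja : j ≤ a.natDegree) {k : ℕ} (hk : j < k) :
    (orderPoly a j).coeff k = 0 := by
  rcases eq_or_ne j 0 with rfl | hj
  · rw [orderPoly_zero, coeff_one, if_neg (by omega)]
  · rw [coeff_orderPoly a hj hja, if_neg (by omega)]

theorem coeff_orderPoly_self (a : ℤ[X]) {j : ℕ} (hja : j ≤ a.natDegree) :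
    (orderPoly a j).coeff j = if j = 0 then 1 else a.leadingCoeff := by
  rcases eq_or_ne j 0 with rfl | hj
  · simp [orderPoly_zero]
  · rw [coeff_orderPoly a hj hja, if_pos (by omega), if_neg hj, leadingCoeff]
    congr 1
    omega

theorem natDegree_orderPoly_le (a : ℤ[X]) {j : ℕ} (hja : j ≤ a.natDegree) :
    (orderPoly a j).natDegree ≤ j :=
  natDegree_le_iff_coeff_eq_zero.2 fun _ hk => coeff_orderPoly_of_lt a hja hk

/-- The polynomial `orderPoly a j` consists of the leading `j` terms of `a`, divided by
`X ^ (n - j)`. -/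
theorem natDegree_sub_X_pow_mul_orderPoly_le (a : ℤ[X]) {j : ℕ} (hj : j ≠ 0)
    (hja : j ≤ a.natDegree) :
    (a - X ^ (a.natDegree - j) * orderPoly a j).natDegree ≤ a.natDegree - j := by
  refine natDegree_le_iff_coeff_eq_zero.2 fun k hk => ?_
  rw [coeff_sub, coeff_X_pow_mul', if_pos hk.le, coeff_orderPoly a hj hja, sub_eq_zero]
  split_ifs with h
  · congr 1
    omega
  · rw [coeff_eq_zero_of_natDegree_lt]
    omega

section Lattices

variable {n : ℕ} {f : ℤ[X]}

theorem aeval_rootClass_self (f : ℤ[X]) : aeval (rootClass f) f = 0 := by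
  have h1 := AdjoinRoot.eval₂_root (f.map (Int.castRingHom ℚ))
  rw [eval₂_map] at h1
  rw [aeval_def, ← h1]
  congr 1

theorem aeval_rootClass (f p : ℤ[X]) :
    aeval (rootClass f) p = AdjoinRoot.mk _ (p.map (Int.castRingHom ℚ)) := by
  rw [← AdjoinRoot.aeval_eq, aeval_def, aeval_def, eval₂_map]
  congr 1

theorem eq_zero_of_aeval_rootClass {p : ℤ[X]} (hp : p.degree < f.degree)
    (h : aeval (rootClass f) p = 0) : p = 0 := by
  have hinj : Function.Injective (Int.castRingHom ℚ) := RingHom.injective_int _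
  rw [aeval_rootClass, AdjoinRoot.mk_eq_zero] at h
  have h1 := eq_zero_of_dvd_of_degree_lt h (by
    rwa [degree_map_eq_of_injective hinj, degree_map_eq_of_injective hinj])
  exact (Polynomial.map_eq_zero_iff hinj).1 h1

/-- The lattice `ℤ + ℤ α + ⋯ + ℤ α ^ (n - 1)` in `K_f`. -/
def powerLattice (n : ℕ) (f : ℤ[X]) : Submodule ℤ (rootAlgebra f) :=
  Submodule.span ℤ (Set.range fun j : Fin n => rootClass f ^ (j : ℕ))

/-- The lattice in `K_f` spanned by the values at `α` of the polynomials `orderPoly a j` with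
`j < n`. It is the invariant order for `a = f`, and the multiplier ring of the lattice
`ℤ + ℤ α + ⋯ + ℤ α ^ (n - 1)` when `a` is the primitive part of `f`. -/
def orderLattice (n : ℕ) (f a : ℤ[X]) : Submodule ℤ (rootAlgebra f) :=
  Submodule.span ℤ (Set.range fun j : Fin n => aeval (rootClass f) (orderPoly a j))

theorem aeval_mem_powerLattice {p : ℤ[X]} (hp : p.degree < n) :
    aeval (rootClass f) p ∈ powerLattice n f := by
  rw [aeval_eq_sum_range]
  refine Submodule.sum_mem _ fun i _ => ?_
  by_cases hi : i < n
  · exact Submodule.smul_mem _ _ (Submodule.subset_span ⟨⟨i, hi⟩, rfl⟩)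
  · rw [coeff_eq_zero_of_degree_lt (hp.trans_le (by exact_mod_cast not_lt.1 hi)), zero_smul]
    exact zero_mem _

theorem mem_powerLattice_iff {x : rootAlgebra f} :
    x ∈ powerLattice n f ↔ ∃ p : ℤ[X], p.degree < n ∧ aeval (rootClass f) p = x := by
  constructor
  · intro h
    obtain ⟨c, rfl⟩ := (Submodule.mem_span_range_iff_exists_fun ℤ).1 h
    refine ⟨∑ i : Fin n, c i • X ^ (i : ℕ), ?_, by simp⟩
    refine mem_degreeLT.1 (Submodule.sum_mem _ fun i _ => Submodule.smul_mem _ _ ?_)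
    exact mem_degreeLT.2 (by rw [degree_X_pow]; exact_mod_cast i.2)
  · rintro ⟨p, hp, rfl⟩
    exact aeval_mem_powerLattice hp

theorem orderPoly_mul_mem_powerLattice {a : ℤ[X]} (han : a.natDegree = n)
    (ha : aeval (rootClass f) a = 0) (j : Fin n) {y : rootAlgebra f}
    (hy : y ∈ powerLattice n f) :
    aeval (rootClass f) (orderPoly a j) * y ∈ powerLattice n f := by
  rw [powerLattice] at hy
  induction hy using Submodule.span_induction with
  | zero => rw [mul_zero]; exact zero_mem _
  | add u v _ _ hu hv => rw [mul_add]; exact add_mem hu hv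
  | smul m u _ hu => rw [mul_smul_comm]; exact Submodule.smul_mem _ _ hu
  | mem y hy =>
    obtain ⟨i, rfl⟩ := hy
    rcases eq_or_ne (j : ℕ) 0 with hj | hj
    · rw [hj, orderPoly_zero, map_one, one_mul]
      exact Submodule.subset_span ⟨i, rfl⟩
    have hjn := j.2
    have hin := i.2
    have hX : rootClass f ^ (i : ℕ) = aeval (rootClass f) (X ^ (i : ℕ) : ℤ[X]) := by simp
    have hXle : ∀ m : ℕ, (X ^ m : ℤ[X]).natDegree ≤ m := fun m => natDegree_X_pow_le m
    simp only [hX]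
    rw [← map_mul]
    by_cases hij : (j : ℕ) + i < n
    · refine aeval_mem_powerLattice (degree_le_natDegree.trans_lt (Nat.cast_lt.2 ?_))
      have := natDegree_mul_le_of_le (natDegree_orderPoly_le a (j := j) (by omega)) (hXle i)
      omega
    · -- the leading terms of `a` are traded for its trailing terms
      have h1 := natDegree_sub_X_pow_mul_orderPoly_le a hj (by omega)
      have h2 : aeval (rootClass f) (orderPoly a j * X ^ (i : ℕ))
          = aeval (rootClass f) (-((a - X ^ (a.natDegree - j) * orderPoly a j)
              * X ^ ((i : ℕ) - (n - j)))) := by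
        have h3 : (i : ℕ) = (n - j) + (i - (n - j)) := by omega
        rw [map_neg, map_mul _ (a - _), map_sub, ha, zero_sub, neg_mul, neg_neg, ← map_mul, han]
        congr 1
        conv_lhs => rw [h3, pow_add]
        ring
      rw [h2]
      refine aeval_mem_powerLattice (degree_le_natDegree.trans_lt (Nat.cast_lt.2 ?_))
      rw [natDegree_neg]
      have := natDegree_mul_le_of_le h1 (hXle (i - (n - j)))
      omega

theorem mul_mem_powerLattice {a : ℤ[X]} (han : a.natDegree = n)
    (ha : aeval (rootClass f) a = 0) {x y : rootAlgebra f} (hx : x ∈ orderLattice n f a)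
    (hy : y ∈ powerLattice n f) : x * y ∈ powerLattice n f := by
  rw [orderLattice] at hx
  induction hx using Submodule.span_induction with
  | zero => rw [zero_mul]; exact zero_mem _
  | add u v _ _ hu hv => rw [add_mul]; exact add_mem hu hv
  | smul m u _ hu => rw [smul_mul_assoc]; exact Submodule.smul_mem _ _ hu
  | mem x hx =>
    obtain ⟨j, rfl⟩ := hx
    exact orderPoly_mul_mem_powerLattice han ha j hy

theorem aeval_primPart (hf : f ≠ 0) : aeval (rootClass f) f.primPart = 0 := by
  have h := aeval_rootClass_self f
  rw [f.eq_C_content_mul_primPart, map_mul, aeval_C, ← f.eq_C_content_mul_primPart,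
    eq_intCast (algebraMap ℤ (rootAlgebra f)), ← zsmul_eq_mul] at h
  have h2 : ((f.content : ℤ) : ℚ) • aeval (rootClass f) f.primPart = 0 := by
    rw [← h, Int.cast_smul_eq_zsmul]
  exact (smul_eq_zero.1 h2).resolve_left (by
    exact_mod_cast mt content_eq_zero_iff.1 hf)

/-- An element `p(α)` which multiplies the lattice spanned by the powers of `α` into itself belongs
to the order of the primitive part `a` of `f`. If `p` has degree `k`, then `p(α) α ^ (n - k)`
belongs to the lattice, so `a₀` divides the leading coefficient of `p` times every coefficient of
`a`. As `a` is primitive, a multiple of the basis element of index `k` can be subtracted to lower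
the degree. -/
theorem aeval_mem_orderLattice_of_mul_mem (hf : f.natDegree = n) (hf0 : f ≠ 0) (k : ℕ)
    (hk : k < n) (p : ℤ[X]) (hp : p.natDegree ≤ k)
    (h : ∀ y ∈ powerLattice n f, aeval (rootClass f) p * y ∈ powerLattice n f) :
    aeval (rootClass f) p ∈ orderLattice n f f.primPart := by
  have hbasis : ∀ j, j < n →
      aeval (rootClass f) (orderPoly f.primPart j) ∈ orderLattice n f f.primPart :=
    fun j hj => Submodule.subset_span ⟨⟨j, hj⟩, rfl⟩
  have han : f.primPart.natDegree = n := by rw [natDegree_primPart, hf]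
  induction k generalizing p with
  | zero =>
    have h1 : p = p.coeff 0 • orderPoly f.primPart 0 := by
      rw [orderPoly_zero, smul_eq_C_mul, mul_one]
      exact eq_C_of_natDegree_le_zero hp
    rw [h1, map_smul]
    exact Submodule.smul_mem _ _ (hbasis 0 hk)
  | succ k ih =>
    set a := f.primPart with ha
    have h1 := h (rootClass f ^ (n - (k + 1))) (Submodule.subset_span ⟨⟨n - (k + 1), by omega⟩, rfl⟩)
    obtain ⟨m, hm, hm2⟩ := mem_powerLattice_iff.1 h1
    have h2 : C a.leadingCoeff * (p * X ^ (n - (k + 1)) - m) - C (p.coeff (k + 1)) * a = 0 := by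
      refine eq_zero_of_aeval_rootClass (f := f) ?_ ?_
      · rw [degree_eq_natDegree hf0, hf, degree_lt_iff_coeff_zero]
        intro i hi
        simp only [coeff_sub, coeff_C_mul, coeff_mul_X_pow']
        rw [coeff_eq_zero_of_degree_lt (hm.trans_le (by exact_mod_cast hi)), if_pos (by omega)]
        rcases hi.eq_or_lt with rfl | hi
        · rw [leadingCoeff, han, show n - (n - (k + 1)) = k + 1 by omega]
          ring
        · rw [coeff_eq_zero_of_natDegree_lt (p := p) (by omega),
            coeff_eq_zero_of_natDegree_lt (p := a) (by omega)]
          ring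
      · simp [hm2, ha, aeval_primPart hf0]
    have h3 : a.leadingCoeff ∣ p.coeff (k + 1) := by
      have h4 : C a.leadingCoeff ∣ C (p.coeff (k + 1)) * a := ⟨_, (sub_eq_zero.1 h2).symm⟩
      rw [← dvd_content_iff_C_dvd, content_C_mul, ha, f.isPrimitive_primPart.content_eq_one,
        mul_one, dvd_normalize_iff] at h4
      exact h4
    obtain ⟨u, hu⟩ := h3
    have h5 : p = (p - u • orderPoly a (k + 1)) + u • orderPoly a (k + 1) := by ring
    have h6 : aeval (rootClass f) (u • orderPoly a (k + 1)) ∈ orderLattice n f a := by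
      rw [map_smul]
      exact Submodule.smul_mem _ _ (hbasis _ hk)
    rw [h5, map_add]
    refine add_mem (ih (by omega) _ ?_ fun y hy => ?_) h6
    · refine natDegree_le_iff_coeff_eq_zero.2 fun i hi => ?_
      rw [coeff_sub, coeff_smul, smul_eq_mul]
      rcases (Nat.succ_le_of_lt hi).eq_or_lt with rfl | hi
      · rw [coeff_orderPoly_self _ (by omega), if_neg (by omega), hu]
        ring
      · rw [coeff_eq_zero_of_natDegree_lt (p := p) (by omega), coeff_orderPoly_of_lt _ _ hi]
        · ring
        · omega
    · rw [map_sub, sub_mul]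
      exact sub_mem (h y hy) (mul_mem_powerLattice han (aeval_primPart hf0) h6 hy)

/-- The order of the primitive part of `f` is the multiplier ring of the lattice of powers. -/
theorem mem_orderLattice_primPart_iff (hf : f.natDegree = n) (hn : 0 < n) {x : rootAlgebra f} :
    x ∈ orderLattice n f f.primPart
      ↔ ∀ y ∈ powerLattice n f, x * y ∈ powerLattice n f := by
  have hf0 : f ≠ 0 := by rintro rfl; simp at hf; omega
  constructor
  · intro hx y hy
    exact mul_mem_powerLattice (by rw [natDegree_primPart, hf]) (aeval_primPart hf0) hx hy
  · intro h
    have h1 := h 1 (Submodule.subset_span ⟨⟨0, hn⟩, pow_zero _⟩)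
    rw [mul_one] at h1
    obtain ⟨p, hp, rfl⟩ := mem_powerLattice_iff.1 h1
    refine aeval_mem_orderLattice_of_mul_mem hf hf0 (n - 1) (by omega) p ?_ h
    refine natDegree_le_iff_coeff_eq_zero.2 fun i hi => ?_
    exact coeff_eq_zero_of_degree_lt (hp.trans_le (by exact_mod_cast (by omega : n ≤ i)))

theorem aeval_orderPoly_self (f : ℤ[X]) {j : ℕ} (hj : j ≠ 0) :
    aeval (rootClass f) (orderPoly f j) = zetaElt f j := by
  simp [orderPoly, hj, zetaElt]

theorem aeval_orderPoly_eq_content_smul (f : ℤ[X]) {j : ℕ} (hj : j ≠ 0) :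
    aeval (rootClass f) (orderPoly f j)
      = f.content • aeval (rootClass f) (orderPoly f.primPart j) := by
  rw [← map_smul]
  congr 1
  rw [orderPoly, orderPoly, if_neg hj, if_neg hj, Finset.smul_sum, natDegree_primPart]
  refine Finset.sum_congr rfl fun i _ => ?_
  have h : f.coeff (f.natDegree - i) = f.content * f.primPart.coeff (f.natDegree - i) := by
    conv_lhs => rw [f.eq_C_content_mul_primPart, coeff_C_mul, ← f.eq_C_content_mul_primPart]
  rw [h, C_mul, smul_eq_C_mul, mul_assoc]

theorem mem_invariantOrder_iff (hf : f.natDegree = n) (hn : 0 < n) {x : rootAlgebra f} :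
    x ∈ invariantOrder f ↔ x ∈ orderLattice n f f := by
  change x ∈ orderSpan f ↔ _
  constructor
  · intro hx
    have h1 : orderSpan f ≤ (orderLattice n f f).toAddSubgroup := by
      refine (AddSubgroup.closure_le _).2 ?_
      rintro _ (rfl | ⟨i, hi, rfl⟩)
      · exact Submodule.subset_span ⟨⟨0, hn⟩, by simp [orderPoly_zero]⟩
      · have := hi.1
        exact Submodule.subset_span ⟨⟨i, hf ▸ hi.2⟩, aeval_orderPoly_self f (by omega : i ≠ 0)⟩
    exact h1 hx
  · intro hx
    have h1 : orderLattice n f f ≤ AddSubgroup.toIntSubmodule (orderSpan f) := by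
      refine Submodule.span_le.2 ?_
      rintro _ ⟨j, rfl⟩
      change aeval (rootClass f) (orderPoly f j) ∈ orderSpan f
      rcases eq_or_ne (j : ℕ) 0 with hj | hj
      · rw [hj, orderPoly_zero, map_one]
        exact AddSubgroup.subset_closure (Set.mem_insert _ _)
      · rw [aeval_orderPoly_self f hj]
        exact zetaElt_mem_orderSpan f (by have := j.2; omega)
    exact h1 hx

theorem pair_one_pow {A : Type*} [CommRing A] (a : A) (m : ℕ) :
    ({1, a} : Set A) ^ m = (fun j => a ^ j) '' Set.Iic m := by
  induction m with
  | zero => ext x; simp [eq_comm]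
  | succ m ih =>
    rw [pow_succ, ih]
    ext x
    constructor
    · rintro ⟨_, ⟨j, hj, rfl⟩, y, rfl | rfl, rfl⟩
      · exact ⟨j, (Set.mem_Iic.1 hj).trans (Nat.le_succ m), by simp⟩
      · exact ⟨j + 1, Nat.succ_le_succ hj, pow_succ _ _⟩
    · rintro ⟨j, hj, rfl⟩
      rcases Nat.le_succ_iff.1 (Set.mem_Iic.1 hj) with h | rfl
      · exact ⟨_, ⟨j, h, rfl⟩, 1, Or.inl rfl, mul_one _⟩
      · exact ⟨_, ⟨m, Set.mem_Iic.2 le_rfl, rfl⟩, a, Or.inr rfl, (pow_succ _ _).symm⟩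

/-- The ideal `I_f ^ (n - 1)` is the lattice `ℤ + ℤ α + ⋯ + ℤ α ^ (n - 1)`, which the invariant order
maps into itself. -/
theorem mem_invariantIdeal_pow_iff (hf : f.natDegree = n) (hn : 0 < n) {x : rootAlgebra f} :
    x ∈ invariantIdeal f ^ (n - 1) ↔ x ∈ powerLattice n f := by
  rw [invariantIdeal, Submodule.span_pow, pair_one_pow]
  constructor
  · intro hx
    induction hx using Submodule.span_induction with
    | zero => exact zero_mem _
    | add u v _ _ hu hv => exact add_mem hu hv
    | smul r u _ hu =>
      exact mul_mem_powerLattice hf (aeval_rootClass_self f)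
        ((mem_invariantOrder_iff hf hn).1 r.2) hu
    | mem x hx =>
      obtain ⟨j, hj, rfl⟩ := hx
      have := Set.mem_Iic.1 hj
      exact Submodule.subset_span ⟨⟨j, by omega⟩, rfl⟩
  · intro hx
    rw [powerLattice] at hx
    induction hx using Submodule.span_induction with
    | zero => exact zero_mem _
    | add u v _ _ hu hv => exact add_mem hu hv
    | smul m u _ hu => exact zsmul_mem hu m
    | mem x hx =>
      obtain ⟨j, rfl⟩ := hx
      have := j.2
      exact Submodule.subset_span ⟨j, Set.mem_Iic.2 (by omega), rfl⟩

end Lattices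

/-! ### Isomorphisms of the algebras and transition matrices -/

section Evaluation

variable {n : ℕ} {f g : ℤ[X]} {r s : Fin n → ℂ}

/-- The homomorphism `K_f → ℂ` which maps `α` to the zero `rᵢ` of `f`. -/
def IsRootFamily.evalHom (hr : IsRootFamily f r) (i : Fin n) : rootAlgebra f →ₐ[ℚ] ℂ :=
  AdjoinRoot.liftAlgHom _ (Algebra.ofId ℚ ℂ) (r i) (by
    have h := hr.eval_eq_zero i
    rw [eval_map] at h
    rw [eval₂_map, ← h]
    congr 1)

theorem IsRootFamily.evalHom_rootClass (hr : IsRootFamily f r) (i : Fin n) :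
    hr.evalHom i (rootClass f) = r i :=
  AdjoinRoot.liftAlgHom_root _ _ _ _

theorem IsRootFamily.evalHom_aeval (hr : IsRootFamily f r) (i : Fin n) (p : ℤ[X]) :
    hr.evalHom i (aeval (rootClass f) p) = aeval (r i) p := by
  rw [aeval_def, aeval_def, ← hr.evalHom_rootClass i]
  have h := hom_eval₂ p (algebraMap ℤ (rootAlgebra f)) (hr.evalHom i : rootAlgebra f →+* ℂ)
    (rootClass f)
  refine h.trans ?_
  congr 1
  exact RingHom.ext_int _ _

/-- For distinct zeros, the evaluations embed `K_f` into `ℂ ^ n`. -/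
theorem IsRootFamily.evalHom_ext (hr : IsRootFamily f r) (hf : f ≠ 0)
    (hinj : Function.Injective r) {x y : rootAlgebra f}
    (h : ∀ i, hr.evalHom i x = hr.evalHom i y) : x = y := by
  rw [← sub_eq_zero]
  have h' : ∀ i, hr.evalHom i (x - y) = 0 := fun i => by rw [map_sub, h, sub_self]
  generalize x - y = z at h'
  clear h
  obtain ⟨p, rfl⟩ := AdjoinRoot.mk_surjective z
  rw [AdjoinRoot.mk_eq_zero]
  rw [← map_dvd_map' (algebraMap ℚ ℂ)]
  rw [Polynomial.map_map, show (algebraMap ℚ ℂ).comp (Int.castRingHom ℚ) = Int.castRingHom ℂ from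
    RingHom.ext_int _ _, hr]
  rw [C_mul_dvd (by simpa using hf)]
  refine Finset.prod_dvd_of_coprime (fun i _ j _ hij => ?_) fun i _ => ?_
  · exact isCoprime_X_sub_C_of_isUnit_sub (isUnit_iff_ne_zero.2 (sub_ne_zero.2 (hinj.ne hij)))
  · rw [dvd_iff_isRoot, IsRoot.def, eval_map]
    exact h' i

/-- Two families with the same `ℤ`-span differ by a unimodular matrix if one of them is mapped to a
basis of `ℂ ^ n`. -/
theorem exists_matrix_of_span_eq {K : Type*} [CommRing K] (ev : Fin n → K →+* ℂ)
    (v w : Fin n → K) (hw : (Matrix.of fun i j => ev i (w j)).det ≠ 0)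
    (h : Submodule.span ℤ (Set.range v) = Submodule.span ℤ (Set.range w)) :
    ∃ P Q : Matrix (Fin n) (Fin n) ℤ, P * Q = 1 ∧ (Matrix.of fun i j => ev i (v j))
      = (Matrix.of fun i j => ev i (w j)) * P.map (Int.cast : ℤ → ℂ) := by
  have key : ∀ v w : Fin n → K, Submodule.span ℤ (Set.range v) ≤ Submodule.span ℤ (Set.range w) →
      ∃ P : Matrix (Fin n) (Fin n) ℤ, (Matrix.of fun i j => ev i (v j))
        = (Matrix.of fun i j => ev i (w j)) * P.map (Int.cast : ℤ → ℂ) := by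
    intro v w h
    have h1 : ∀ j, ∃ c : Fin n → ℤ, ∑ k, c k • w k = v j := fun j =>
      (Submodule.mem_span_range_iff_exists_fun ℤ).1 (h (Submodule.subset_span ⟨j, rfl⟩))
    choose c hc using h1
    refine ⟨Matrix.of fun k j => c j k, ?_⟩
    ext i j
    rw [Matrix.mul_apply, Matrix.of_apply, ← hc j, map_sum]
    exact Finset.sum_congr rfl fun k _ => by simp [mul_comm]
  obtain ⟨P, hP⟩ := key v w h.le
  obtain ⟨Q, hQ⟩ := key w v h.ge
  exact ⟨P, Q, mul_eq_one_of_basis_change hw hP hQ, hP⟩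

theorem coe_span_range_comp {K L : Type*} [AddCommGroup K] [AddCommGroup L] (φ : K →+ L)
    (v : Fin n → K) :
    (Submodule.span ℤ (Set.range fun j => φ (v j)) : Set L)
      = φ '' (Submodule.span ℤ (Set.range v) : Set K) := by
  have h := Submodule.map_span φ.toIntLinearMap (Set.range v)
  rw [← Set.range_comp] at h
  exact (congrArg SetLike.coe h).symm

theorem mapsToMultiple_iff (hf : f.natDegree = n) (hg : g.natDegree = n) (hn : 0 < n)
    (Φ : rootAlgebra f ≃ₐ[ℚ] rootAlgebra g) :
    MapsToMultiple Φ (invariantIdeal f ^ (n - 1)) (invariantIdeal g ^ (n - 1)) ↔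
      ∃ κ : (rootAlgebra g)ˣ, Φ '' (powerLattice n f : Set (rootAlgebra f))
        = (fun x => (κ : rootAlgebra g) * x) '' (powerLattice n g : Set (rootAlgebra g)) := by
  have h1 : ((invariantIdeal f ^ (n - 1) : Submodule _ _) : Set (rootAlgebra f))
      = powerLattice n f := Set.ext fun x => mem_invariantIdeal_pow_iff hf hn
  have h2 : ((invariantIdeal g ^ (n - 1) : Submodule _ _) : Set (rootAlgebra g))
      = powerLattice n g := Set.ext fun x => mem_invariantIdeal_pow_iff hg hn
  rw [MapsToMultiple, h1, h2]

/-- An isomorphism `K_f → K_g` permutes the evaluations at the zeros. -/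
theorem exists_perm_evalHom (hr : IsRootFamily f r) (hs : IsRootFamily g s)
    (hsinj : Function.Injective s) (hf : f ≠ 0) (Φ : rootAlgebra f ≃ₐ[ℚ] rootAlgebra g) :
    ∃ σ : Equiv.Perm (Fin n), ∀ i x, hs.evalHom i (Φ x) = hr.evalHom (σ i) x := by
  have hroot : ∀ i, ∃ k, r k = hs.evalHom i (Φ (rootClass f)) := by
    intro i
    refine hr.mem_range_of_eval_eq_zero hf ?_
    have h1 := congrArg (((hs.evalHom i).comp (Φ : rootAlgebra f →ₐ[ℚ] rootAlgebra g) :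
      rootAlgebra f →ₐ[ℚ] ℂ) : rootAlgebra f →+* ℂ) (aeval_rootClass_self f)
    rw [aeval_def, hom_eval₂, map_zero] at h1
    rw [eval_map, ← h1]
    congr 1
    exact RingHom.ext_int _ _
  choose σ hσ using hroot
  have hcomp : ∀ i, (hs.evalHom i).comp (Φ : rootAlgebra f →ₐ[ℚ] rootAlgebra g)
      = hr.evalHom (σ i) := fun i =>
    AdjoinRoot.algHom_ext ((hσ i).symm.trans (hr.evalHom_rootClass (σ i)).symm)
  have hcomp' : ∀ i x, hs.evalHom i (Φ x) = hr.evalHom (σ i) x := fun i x =>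
    DFunLike.congr_fun (hcomp i) x
  have hσinj : Function.Injective σ := by
    intro i i' hii
    apply hsinj
    rw [← hs.evalHom_rootClass i, ← hs.evalHom_rootClass i', ← Φ.apply_symm_apply (rootClass g),
      hcomp', hcomp', hii]
  exact ⟨Equiv.ofBijective σ (Finite.injective_iff_bijective.1 hσinj), hcomp'⟩

theorem IsRootFamily.of_evalHom_pow (hr : IsRootFamily f r) :
    (Matrix.of fun i j : Fin n => hr.evalHom i (rootClass f ^ (j : ℕ))) = vandermonde r := by
  ext i j
  rw [Matrix.of_apply, map_pow, hr.evalHom_rootClass, vandermonde_apply]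

/-- The factors of the transition attached to an isomorphism with `Φ(I_f ^ (n - 1)) = κ I_g ^ (n - 1)`
are the inverses of the images of `κ` in `ℂ`. -/
theorem exists_isTransition_of_mapsToMultiple (hf : f.natDegree = n) (hg : g.natDegree = n)
    (hn : 0 < n) (hr : IsRootFamily f r) (hs : IsRootFamily g s)
    (hsinj : Function.Injective s) {Φ : rootAlgebra f ≃ₐ[ℚ] rootAlgebra g}
    (h : MapsToMultiple Φ (invariantIdeal f ^ (n - 1)) (invariantIdeal g ^ (n - 1))) :
    ∃ P Q : Matrix (Fin n) (Fin n) ℤ, P * Q = 1 ∧ ∃ σ c, IsTransition r s P σ c ∧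
      ∀ i x, hs.evalHom i (Φ x) = hr.evalHom (σ i) x := by
  have hf0 : f ≠ 0 := by rintro rfl; simp at hf; omega
  obtain ⟨κ, hκ⟩ := (mapsToMultiple_iff hf hg hn Φ).1 h
  obtain ⟨σ, hσ⟩ := exists_perm_evalHom hr hs hsinj hf0 Φ
  have hκ0 : ∀ i, hs.evalHom i κ ≠ 0 := fun i =>
    (κ.isUnit.map (hs.evalHom i)).ne_zero
  have hw : (Matrix.of fun i j : Fin n => hs.evalHom i (κ * rootClass g ^ (j : ℕ)))
      = diagonal (fun i => hs.evalHom i κ) * vandermonde s := by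
    ext i j
    rw [Matrix.of_apply, diagonal_mul, map_mul, ← hs.of_evalHom_pow]
    rfl
  have hspan : Submodule.span ℤ (Set.range fun j : Fin n => Φ (rootClass f ^ (j : ℕ)))
      = Submodule.span ℤ (Set.range fun j : Fin n => (κ : rootAlgebra g) * rootClass g ^ (j : ℕ)) := by
    apply SetLike.coe_injective
    have h1 := coe_span_range_comp (Φ : rootAlgebra f →+ rootAlgebra g)
      fun j : Fin n => rootClass f ^ (j : ℕ)
    have h2 := coe_span_range_comp (AddMonoidHom.mulLeft (κ : rootAlgebra g))
      fun j : Fin n => rootClass g ^ (j : ℕ)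
    exact h1.trans (hκ.trans h2.symm)
  obtain ⟨P, Q, hPQ, hP⟩ := exists_matrix_of_span_eq
    (fun i => (hs.evalHom i : rootAlgebra g →+* ℂ)) _ _ (by
      refine ne_of_eq_of_ne (congrArg det hw) ?_
      rw [det_mul, det_diagonal]
      exact mul_ne_zero (Finset.prod_ne_zero_iff.2 fun i _ => hκ0 i)
        (det_vandermonde_ne_zero_iff.2 hsinj)) hspan
  refine ⟨P, Q, hPQ, σ, fun i => (hs.evalHom i κ)⁻¹, fun i j => ?_, hσ⟩
  have h1 : hs.evalHom i (Φ (rootClass f ^ (j : ℕ))) = _ := congrFun (congrFun hP i) j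
  have h2 := congrArg (fun A => (A * P.map (Int.cast : ℤ → ℂ)) i j) hw
  have h3 := h1.trans h2
  rw [Matrix.mul_assoc, diagonal_mul, hσ, map_pow, hr.evalHom_rootClass] at h3
  rw [h3, inv_mul_cancel_left₀ (hκ0 i)]

/-- A transition matrix between the zeros of `f` and `g` defines an isomorphism `K_f → K_g`: with
`β` the class of `X` in `K_g`, the element `α` is mapped to the quotient of `∑ P_{k1} β ^ k` by the
unit `∑ P_{k0} β ^ k`. -/
theorem IsTransition.exists_algEquiv (hf : f.natDegree = n) (hg : g.natDegree = n)
    (hn : 2 ≤ n) (hr : IsRootFamily f r) (hs : IsRootFamily g s)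
    (hrinj : Function.Injective r) (hsinj : Function.Injective s)
    {P Q : Matrix (Fin n) (Fin n) ℤ} {σ : Equiv.Perm (Fin n)} {c : Fin n → ℂ} (hPQ : P * Q = 1)
    (hc : ∀ i, c i ≠ 0) (h : IsTransition r s P σ c) :
    ∃ Φ : rootAlgebra f ≃ₐ[ℚ] rootAlgebra g,
      (∀ i x, hs.evalHom i (Φ x) = hr.evalHom (σ i) x) ∧
      MapsToMultiple Φ (invariantIdeal f ^ (n - 1)) (invariantIdeal g ^ (n - 1)) := by
  have hinjQ : Function.Injective (Int.castRingHom ℚ) := RingHom.injective_int _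
  have hf1 : f ≠ 0 := by rintro rfl; simp at hf; omega
  have hg1 : g ≠ 0 := by rintro rfl; simp at hg; omega
  have hf0 : f.map (Int.castRingHom ℚ) ≠ 0 := mt (Polynomial.map_eq_zero_iff hinjQ).1 hf1
  have hg0 : g.map (Int.castRingHom ℚ) ≠ 0 := mt (Polynomial.map_eq_zero_iff hinjQ).1 hg1
  have hfinf : Module.Finite ℚ (rootAlgebra f) := (AdjoinRoot.powerBasis hf0).finite
  have hfing : Module.Finite ℚ (rootAlgebra g) := (AdjoinRoot.powerBasis hg0).finite
  let col : Fin n → rootAlgebra g := fun j => ∑ k, P k j • rootClass g ^ (k : ℕ)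
  have hcol : ∀ i j, hs.evalHom i (col j) = c i * r (σ i) ^ (j : ℕ) := by
    intro i j
    rw [← h.sum_eq i j, map_sum]
    refine Finset.sum_congr rfl fun k _ => ?_
    rw [map_zsmul, map_pow, hs.evalHom_rootClass, zsmul_eq_mul]
  have hu : IsUnit (col ⟨0, by omega⟩) := by
    have : IsArtinianRing (rootAlgebra g) := IsArtinianRing.of_finite ℚ _
    refine IsArtinianRing.isUnit_of_mem_nonZeroDivisors
      (mem_nonZeroDivisors_iff_right.2 fun x hx => ?_)
    refine hs.evalHom_ext hg1 hsinj fun i => ?_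
    have h1 := congrArg (hs.evalHom i) hx
    rw [map_mul, hcol, map_zero, pow_zero, mul_one] at h1
    rw [(mul_eq_zero.1 h1).resolve_right (hc i), map_zero]
  obtain ⟨u, hu⟩ := hu
  have hu_eval : ∀ i, hs.evalHom i (u : rootAlgebra g) = c i := fun i => by
    rw [hu, hcol, pow_zero, mul_one]
  let θ : rootAlgebra g := ((u⁻¹ : (rootAlgebra g)ˣ) : rootAlgebra g) * col ⟨1, by omega⟩
  have hθ : ∀ i, hs.evalHom i θ = r (σ i) := by
    intro i
    have h1 : (u : rootAlgebra g) * θ = col ⟨1, by omega⟩ := Units.mul_inv_cancel_left _ _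
    have h2 := congrArg (hs.evalHom i) h1
    rw [map_mul, hu_eval, hcol, pow_one] at h2
    exact mul_left_cancel₀ (hc i) h2
  have hroot : (f.map (Int.castRingHom ℚ)).eval₂ (Algebra.ofId ℚ (rootAlgebra g)) θ = 0 := by
    refine hs.evalHom_ext hg1 hsinj fun i => ?_
    have h1 := hom_eval₂ (f.map (Int.castRingHom ℚ)) (Algebra.ofId ℚ (rootAlgebra g) : ℚ →+* _)
      (hs.evalHom i : rootAlgebra g →+* ℂ) θ
    have h2 := hr.eval_eq_zero (σ i)
    rw [map_zero, ← h2]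
    refine h1.trans ?_
    rw [eval₂_map, eval_map, ← hθ i]
    congr 1
    exact RingHom.ext_int _ _
  let φ : rootAlgebra f →ₐ[ℚ] rootAlgebra g := AdjoinRoot.liftAlgHom _ _ θ hroot
  have hφ : ∀ i x, hs.evalHom i (φ x) = hr.evalHom (σ i) x := by
    intro i x
    have : (hs.evalHom i).comp φ = hr.evalHom (σ i) := by
      refine AdjoinRoot.algHom_ext ?_
      refine Eq.trans ?_ (hr.evalHom_rootClass (σ i)).symm
      rw [AlgHom.comp_apply, AdjoinRoot.liftAlgHom_root, hθ]
    exact DFunLike.congr_fun this x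
  have hφinj : Function.Injective φ := by
    refine (injective_iff_map_eq_zero φ).2 fun x hx => ?_
    refine hr.evalHom_ext hf1 hrinj fun i => ?_
    rw [← σ.apply_symm_apply i, ← hφ, hx, map_zero, map_zero]
  have hrank : Module.finrank ℚ (rootAlgebra f) = Module.finrank ℚ (rootAlgebra g) := by
    rw [(AdjoinRoot.powerBasis hf0).finrank, (AdjoinRoot.powerBasis hg0).finrank,
      AdjoinRoot.powerBasis_dim, AdjoinRoot.powerBasis_dim,
      natDegree_map_eq_of_injective hinjQ, natDegree_map_eq_of_injective hinjQ, hf, hg]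
  have hφsurj : Function.Surjective φ :=
    (LinearMap.injective_iff_surjective_of_finrank_eq_finrank (f := φ.toLinearMap) hrank).1 hφinj
  refine ⟨AlgEquiv.ofBijective φ ⟨hφinj, hφsurj⟩, hφ,
    (mapsToMultiple_iff hf hg (by omega) _).2 ⟨u⁻¹, ?_⟩⟩
  have hpow : ∀ j : Fin n,
      φ (rootClass f ^ (j : ℕ)) = ((u⁻¹ : (rootAlgebra g)ˣ) : rootAlgebra g) * col j := by
    intro j
    rw [Units.eq_inv_mul_iff_mul_eq]
    refine hs.evalHom_ext hg1 hsinj fun i => ?_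
    rw [map_mul, hu_eval, hφ, hcol, map_pow, hr.evalHom_rootClass]
  have hspan : Submodule.span ℤ (Set.range col) = powerLattice n g := by
    refine le_antisymm (Submodule.span_le.2 ?_) (Submodule.span_le.2 ?_)
    · rintro _ ⟨j, rfl⟩
      exact Submodule.sum_mem _ fun k _ => Submodule.smul_mem _ _
        (Submodule.subset_span ⟨k, rfl⟩)
    · rintro _ ⟨j, rfl⟩
      have h1 : ∑ k, Q k j • col k = rootClass g ^ (j : ℕ) := by
        simp only [col, Finset.smul_sum, smul_smul]
        rw [Finset.sum_comm]
        simp only [← Finset.sum_smul]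
        rw [Finset.sum_eq_single j]
        · have h2 : ∑ k, Q k j * P j k = 1 := by
            have := congrFun (congrFun hPQ j) j
            rw [Matrix.mul_apply, Matrix.one_apply_eq] at this
            simpa [mul_comm] using this
          rw [h2, one_smul]
        · intro l _ hl
          have h2 : ∑ k, Q k j * P l k = 0 := by
            have := congrFun (congrFun hPQ l) j
            rw [Matrix.mul_apply, Matrix.one_apply_ne hl] at this
            simpa [mul_comm] using this
          rw [h2, zero_smul]
        · simp
      change rootClass g ^ (j : ℕ) ∈ Submodule.span ℤ (Set.range col)
      rw [← h1]
      exact Submodule.sum_mem _ fun k _ => Submodule.smul_mem _ _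
        (Submodule.subset_span ⟨k, rfl⟩)
  have h1 := coe_span_range_comp (φ : rootAlgebra f →+ rootAlgebra g)
    fun j : Fin n => rootClass f ^ (j : ℕ)
  have h2 := coe_span_range_comp
    (AddMonoidHom.mulLeft ((u⁻¹ : (rootAlgebra g)ˣ) : rootAlgebra g)) col
  rw [hspan] at h2
  refine Eq.trans h1.symm (Eq.trans ?_ h2)
  congr 3
  exact funext hpow

/-- The upper triangular matrix of the polynomials `orderPoly a j` in the basis of powers. -/
def orderMatrix (n : ℕ) (a : ℤ[X]) : Matrix (Fin n) (Fin n) ℂ :=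
  Matrix.of fun k j => ((orderPoly a j).coeff k : ℂ)

theorem det_orderMatrix (hn : 0 < n) {a : ℤ[X]} (ha : a.natDegree = n) :
    (orderMatrix n a).det = (a.leadingCoeff : ℂ) ^ (n - 1) := by
  have h1 : (orderMatrix n a).BlockTriangular id := by
    intro k j hjk
    have hj := j.2
    have : (orderPoly a j).coeff k = 0 := coeff_orderPoly_of_lt a (by omega) hjk
    simp [orderMatrix, this]
  rw [det_of_isUpperTriangular h1]
  have h2 : ∀ j : Fin n, orderMatrix n a j j = if (j : ℕ) = 0 then 1 else (a.leadingCoeff : ℂ) := by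
    intro j
    have hj := j.2
    rw [orderMatrix, Matrix.of_apply, coeff_orderPoly_self a (by omega)]
    split_ifs <;> simp
  simp only [h2]
  obtain ⟨m, rfl⟩ := Nat.exists_eq_succ_of_ne_zero hn.ne'
  rw [Fin.prod_univ_succ]
  simp

theorem IsRootFamily.of_evalHom_orderPoly (hr : IsRootFamily f r) {a : ℤ[X]}
    (ha : a.natDegree = n) :
    (Matrix.of fun i j : Fin n => hr.evalHom i (aeval (rootClass f) (orderPoly a j)))
      = vandermonde r * orderMatrix n a := by
  ext i j
  have hj := j.2
  rw [Matrix.of_apply, hr.evalHom_aeval, Matrix.mul_apply,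
    aeval_eq_sum_range' ((natDegree_orderPoly_le a (j := j) (by omega)).trans_lt hj),
    ← Fin.sum_univ_eq_sum_range fun k => (orderPoly a j).coeff k • r i ^ k]
  refine Finset.sum_congr rfl fun k _ => ?_
  rw [orderMatrix, Matrix.of_apply, vandermonde_apply, zsmul_eq_mul, mul_comm]

/-- The product of the factors of a transition is, up to sign, the ratio of the indices of the
lattices of powers with respect to the orders. Both orders are compared with the lattices of powers
through determinants of complex matrices. -/
theorem IsTransition.leadingCoeff_pow_eq (hn : 0 < n) (hr : IsRootFamily f r)
    (hs : IsRootFamily g s) (hrinj : Function.Injective r) (hsinj : Function.Injective s)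
    {P Q : Matrix (Fin n) (Fin n) ℤ} {σ : Equiv.Perm (Fin n)} {c : Fin n → ℂ} (hPQ : P * Q = 1)
    (h : IsTransition r s P σ c) {Φ : rootAlgebra f ≃ₐ[ℚ] rootAlgebra g}
    (hΦ : ∀ i x, hs.evalHom i (Φ x) = hr.evalHom (σ i) x) {a b : ℤ[X]}
    (ha : a.natDegree = n) (hb : b.natDegree = n)
    (hab : Φ '' (orderLattice n f a : Set (rootAlgebra f)) = orderLattice n g b) :
    ((b.leadingCoeff : ℂ) ^ (n - 1) * ∏ i, c i) ^ 2 = ((a.leadingCoeff : ℂ) ^ (n - 1)) ^ 2 := by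
  have hb0 : (b.leadingCoeff : ℂ) ≠ 0 := by
    have : b ≠ 0 := by rintro rfl; simp at hb; omega
    simpa using this
  have hV := det_vandermonde_ne_zero_iff.2 hrinj
  have hspan : Submodule.span ℤ
      (Set.range fun j : Fin n => Φ (aeval (rootClass f) (orderPoly a j)))
      = Submodule.span ℤ (Set.range fun j : Fin n => aeval (rootClass g) (orderPoly b j)) := by
    apply SetLike.coe_injective
    exact (coe_span_range_comp (Φ : rootAlgebra f →+ rootAlgebra g)
      fun j : Fin n => aeval (rootClass f) (orderPoly a j)).trans hab
  obtain ⟨S, T, hST, hS⟩ := exists_matrix_of_span_eq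
    (fun i => (hs.evalHom i : rootAlgebra g →+* ℂ)) _ _ (by
      refine ne_of_eq_of_ne (congrArg det (hs.of_evalHom_orderPoly hb)) ?_
      rw [det_mul, det_orderMatrix hn hb]
      exact mul_ne_zero (det_vandermonde_ne_zero_iff.2 hsinj) (pow_ne_zero _ hb0)) hspan
  have h1 : (vandermonde r * orderMatrix n a).submatrix σ id
      = vandermonde s * orderMatrix n b * S.map (Int.cast : ℤ → ℂ) := by
    rw [← hs.of_evalHom_orderPoly hb, ← hr.of_evalHom_orderPoly ha]
    refine Eq.trans ?_ hS
    ext i j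
    exact (hΦ i _).symm
  have h2 := congrArg (fun M => M.det ^ 2) h1
  simp only [det_submatrix_perm_sq, det_mul, mul_pow, det_intCast_sq hST, mul_one,
    det_orderMatrix hn ha, det_orderMatrix hn hb, h.det_vandermonde_sq hPQ] at h2
  refine mul_left_cancel₀ (pow_ne_zero 2 hV) ?_
  rw [mul_pow]
  linear_combination -h2

end Evaluation

/-! ### Isomorphisms of the invariant orders -/

section Comparison

variable {n : ℕ} {f g : ℤ[X]} {r s : Fin n → ℂ}

/-- The multiplier rings of two lattices correspond if one lattice is mapped onto a multiple of the
other. -/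
theorem image_orderLattice_primPart (hf : f.natDegree = n) (hg : g.natDegree = n) (hn : 0 < n)
    {Φ : rootAlgebra f ≃ₐ[ℚ] rootAlgebra g}
    (h : MapsToMultiple Φ (invariantIdeal f ^ (n - 1)) (invariantIdeal g ^ (n - 1))) :
    Φ '' (orderLattice n f f.primPart : Set (rootAlgebra f)) = orderLattice n g g.primPart := by
  obtain ⟨κ, hκ⟩ := (mapsToMultiple_iff hf hg hn Φ).1 h
  have key : ∀ x, x ∈ orderLattice n f f.primPart ↔ Φ x ∈ orderLattice n g g.primPart := by
    intro x
    rw [mem_orderLattice_primPart_iff hf hn, mem_orderLattice_primPart_iff hg hn]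
    constructor
    · intro hx y hy
      obtain ⟨z, hz, hzy⟩ := hκ.ge ⟨y, hy, rfl⟩
      obtain ⟨w, hw, hwz⟩ := hκ.le ⟨x * z, hx z hz, rfl⟩
      have h1 : (κ : rootAlgebra g) * w = κ * (Φ x * y) := by
        refine hwz.trans ?_
        rw [map_mul, hzy]
        ring
      rwa [← κ.isUnit.mul_left_cancel h1]
    · intro hx y hy
      obtain ⟨z, hz, hzy⟩ := hκ.le ⟨y, hy, rfl⟩
      obtain ⟨w, hw, hwz⟩ := hκ.ge ⟨Φ x * z, hx z hz, rfl⟩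
      have h1 : Φ w = Φ (x * y) := by
        rw [hwz, map_mul, ← hzy]
        ring
      rwa [← Φ.injective h1]
  ext y
  constructor
  · rintro ⟨x, hx, rfl⟩
    exact (key x).1 hx
  · intro hy
    refine ⟨Φ.symm y, (key _).2 ?_, Φ.apply_symm_apply y⟩
    rwa [Φ.apply_symm_apply]

theorem content_smul_mem_orderLattice (hn : 0 < n) {x : rootAlgebra f}
    (hx : x ∈ orderLattice n f f.primPart) : f.content • x ∈ orderLattice n f f := by
  rw [orderLattice] at hx
  induction hx using Submodule.span_induction with
  | zero => rw [smul_zero]; exact zero_mem _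
  | add u v _ _ hu hv => rw [smul_add]; exact add_mem hu hv
  | smul m u _ hu => rw [smul_comm]; exact Submodule.smul_mem _ _ hu
  | mem x hx =>
    obtain ⟨j, rfl⟩ := hx
    rcases eq_or_ne (j : ℕ) 0 with hj | hj
    · refine Submodule.smul_mem _ _ (Submodule.subset_span ⟨⟨0, hn⟩, ?_⟩)
      simp only [hj, orderPoly_zero]
    · exact Submodule.subset_span ⟨j, aeval_orderPoly_eq_content_smul f hj⟩

/-- With `c` the content of `f`, the invariant order of `f` is `ℤ + c O`, with `O` the order of the
primitive part. Hence it is determined by `c` and `O`. -/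
theorem map_mem_orderLattice (hn : 0 < n) {Φ : rootAlgebra f →ₐ[ℚ] rootAlgebra g}
    (hc : f.content = g.content)
    (h : ∀ x ∈ orderLattice n f f.primPart, Φ x ∈ orderLattice n g g.primPart)
    {x : rootAlgebra f} (hx : x ∈ orderLattice n f f) : Φ x ∈ orderLattice n g g := by
  rw [orderLattice] at hx
  induction hx using Submodule.span_induction with
  | zero => rw [map_zero]; exact zero_mem _
  | add u v _ _ hu hv => rw [map_add]; exact add_mem hu hv
  | smul m u _ hu => rw [map_zsmul]; exact Submodule.smul_mem _ _ hu
  | mem x hx =>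
    obtain ⟨j, rfl⟩ := hx
    rcases eq_or_ne (j : ℕ) 0 with hj | hj
    · refine Submodule.subset_span ⟨⟨0, hn⟩, ?_⟩
      simp only [hj, orderPoly_zero, map_one]
    · simp only [aeval_orderPoly_eq_content_smul f hj, map_zsmul, hc]
      exact content_smul_mem_orderLattice hn (h _ (Submodule.subset_span ⟨j, rfl⟩))

theorem image_invariantOrder (hf : f.natDegree = n) (hg : g.natDegree = n) (hn : 0 < n)
    {Φ : rootAlgebra f ≃ₐ[ℚ] rootAlgebra g} (hc : f.content = g.content)
    (h : Φ '' (orderLattice n f f.primPart : Set (rootAlgebra f)) = orderLattice n g g.primPart) :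
    Φ '' (invariantOrder f : Set (rootAlgebra f)) = (invariantOrder g : Set (rootAlgebra g)) := by
  ext y
  constructor
  · rintro ⟨x, hx, rfl⟩
    refine (mem_invariantOrder_iff hg hn).2 (map_mem_orderLattice hn
      (Φ := (Φ : rootAlgebra f →ₐ[ℚ] rootAlgebra g)) hc (fun x hx => ?_)
      ((mem_invariantOrder_iff hf hn).1 hx))
    exact h.le ⟨x, hx, rfl⟩
  · intro hy
    refine ⟨Φ.symm y, (mem_invariantOrder_iff hf hn).2 (map_mem_orderLattice hn
      (Φ := (Φ.symm : rootAlgebra g →ₐ[ℚ] rootAlgebra f)) hc.symm (fun x hx => ?_)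
      ((mem_invariantOrder_iff hg hn).1 hy)), Φ.apply_symm_apply y⟩
    obtain ⟨z, hz, rfl⟩ := h.ge hx
    exact (Φ.symm_apply_apply z).symm ▸ hz

theorem HermiteEquivalent.exists_algEquiv (hn : 2 ≤ n) (hf : f.natDegree = n)
    (hg : g.natDegree = n) (hfd : f.discr ≠ 0) (hgd : g.discr ≠ 0) (h : HermiteEquivalent n f g) :
    f.content = g.content ∧ ∃ Φ : rootAlgebra f ≃ₐ[ℚ] rootAlgebra g,
      MapsToMultiple Φ (invariantIdeal f ^ (n - 1)) (invariantIdeal g ^ (n - 1)) := by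
  have hf0 : f ≠ 0 := by rintro rfl; simp at hf; omega
  have hg0 : g ≠ 0 := by rintro rfl; simp at hg; omega
  obtain ⟨r, hr⟩ := exists_isRootFamily hf
  obtain ⟨s, hs⟩ := exists_isRootFamily hg
  have hrinj := hr.injective (by omega) hf hfd
  have hsinj := hs.injective (by omega) hg hgd
  obtain ⟨P, Q, hPQ, σ, c, hT, hc0, ε, hε, hprod⟩ := h.exists_isTransition hn hr hs hsinj hf0 hg0
  obtain ⟨Φ, hΦ, hM⟩ := hT.exists_algEquiv hf hg hn hr hs hrinj hsinj hPQ hc0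
  refine ⟨?_, Φ, hM⟩
  have h1 := hT.leadingCoeff_pow_eq (by omega) hr hs hrinj hsinj hPQ hΦ
    (by rw [natDegree_primPart, hf]) (by rw [natDegree_primPart, hg])
    (image_orderLattice_primPart hf hg (by omega) hM)
  have hlead : ∀ p : ℤ[X], (p.leadingCoeff : ℂ) = p.content * p.primPart.leadingCoeff := by
    intro p
    conv_lhs => rw [p.eq_C_content_mul_primPart, leadingCoeff_mul, leadingCoeff_C]
    push_cast
    rfl
  have hε2 : ε ^ 2 = 1 := by rcases hε with rfl | rfl <;> norm_num
  have h2 : ((g.content : ℂ) ^ (n - 1)) ^ 2 = ((f.content : ℂ) ^ (n - 1)) ^ 2 := by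
    have h3 := congrArg (fun z => z ^ 2) hprod
    simp only [hlead f, hlead g, mul_pow, hε2, one_mul] at h3
    have hne : ((f.primPart.leadingCoeff : ℂ) ^ (n - 1)) ^ 2 ≠ 0 := by
      have : f.primPart.leadingCoeff ≠ 0 := leadingCoeff_ne_zero.2 f.primPart_ne_zero
      exact pow_ne_zero _ (pow_ne_zero _ (by exact_mod_cast this))
    refine mul_right_cancel₀ hne ?_
    rw [mul_pow] at h1
    rw [← h3, ← h1]
    ring
  have h4 : (g.content ^ (n - 1)) ^ 2 = (f.content ^ (n - 1)) ^ 2 := by exact_mod_cast h2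
  have hnn : ∀ p : ℤ[X], 0 ≤ p.content := fun p => Int.nonneg_of_normalize_eq_self normalize_content
  have h5 := (pow_left_inj₀ (pow_nonneg (hnn g) _) (pow_nonneg (hnn f) _) two_ne_zero).1 h4
  exact ((pow_left_inj₀ (hnn g) (hnn f) (by omega)).1 h5).symm

theorem HermiteEquivalent.image_invariantOrder (hn : 2 ≤ n) (hf : f.natDegree = n)
    (hg : g.natDegree = n) (hfd : f.discr ≠ 0) (hgd : g.discr ≠ 0) (h : HermiteEquivalent n f g)
    {Φ : rootAlgebra f ≃ₐ[ℚ] rootAlgebra g}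
    (hΦ : MapsToMultiple Φ (invariantIdeal f ^ (n - 1)) (invariantIdeal g ^ (n - 1))) :
    Φ '' (invariantOrder f : Set (rootAlgebra f)) = (invariantOrder g : Set (rootAlgebra g)) :=
  _root_.image_invariantOrder hf hg (by omega) (h.exists_algEquiv hn hf hg hfd hgd).1
    (image_orderLattice_primPart hf hg (by omega) hΦ)

theorem hermiteEquivalent_of_image (hn : 2 ≤ n) (hf : f.natDegree = n)
    (hg : g.natDegree = n) (hfd : f.discr ≠ 0) (hgd : g.discr ≠ 0)
    {Φ : rootAlgebra f ≃ₐ[ℚ] rootAlgebra g}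
    (hR : Φ '' (invariantOrder f : Set (rootAlgebra f)) = (invariantOrder g : Set (rootAlgebra g)))
    (hΦ : MapsToMultiple Φ (invariantIdeal f ^ (n - 1)) (invariantIdeal g ^ (n - 1))) :
    HermiteEquivalent n f g := by
  have hf0 : f ≠ 0 := by rintro rfl; simp at hf; omega
  have hg0 : g ≠ 0 := by rintro rfl; simp at hg; omega
  obtain ⟨r, hr⟩ := exists_isRootFamily hf
  obtain ⟨s, hs⟩ := exists_isRootFamily hg
  have hrinj := hr.injective (by omega) hf hfd
  have hsinj := hs.injective (by omega) hg hgd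
  obtain ⟨P, Q, hPQ, σ, c, hT, hσ⟩ :=
    exists_isTransition_of_mapsToMultiple hf hg (by omega) hr hs hsinj hΦ
  have hR' : ∀ {p : ℤ[X]}, p.natDegree = n →
      (orderLattice n p p : Set (rootAlgebra p)) = invariantOrder p := fun hp =>
    Set.ext fun x => (mem_invariantOrder_iff hp (by omega)).symm
  have h1 := hT.leadingCoeff_pow_eq (by omega) hr hs hrinj hsinj hPQ hσ hf hg
    (by rw [hR' hf, hR' hg, hR])
  rcases sq_eq_sq_iff_eq_or_eq_neg.1 h1 with h2 | h2
  · exact hT.hermiteEquivalent hr hs hf0 hg0 hPQ (Or.inl rfl) (by rw [h2, one_mul])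
  · exact hT.hermiteEquivalent hr hs hf0 hg0 hPQ (Or.inr rfl) (by rw [h2, neg_one_mul])

theorem exists_ringEquiv_of_image {Φ : rootAlgebra f ≃ₐ[ℚ] rootAlgebra g}
    (hR : Φ '' (invariantOrder f : Set (rootAlgebra f)) =
      (invariantOrder g : Set (rootAlgebra g))) :
    ∃ φ : invariantOrder f ≃+* invariantOrder g,
      ∀ x : invariantOrder f, Φ (x : rootAlgebra f) = (φ x : rootAlgebra g) := by
  let φ : invariantOrder f →+* invariantOrder g :=
    (Φ : rootAlgebra f →+* rootAlgebra g).restrict _ _ fun x hx => hR.le ⟨x, hx, rfl⟩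
  refine ⟨RingEquiv.ofBijective φ ⟨fun x y hxy => ?_, fun y => ?_⟩, fun x => rfl⟩
  · exact Subtype.ext (Φ.injective (congrArg Subtype.val hxy))
  · obtain ⟨x, hx, hxy⟩ := hR.ge y.2
    exact ⟨⟨x, hx⟩, Subtype.ext hxy⟩

theorem image_of_ringEquiv {Φ : rootAlgebra f ≃ₐ[ℚ] rootAlgebra g}
    {φ : invariantOrder f ≃+* invariantOrder g}
    (h : ∀ x : invariantOrder f, Φ (x : rootAlgebra f) = (φ x : rootAlgebra g)) :
    Φ '' (invariantOrder f : Set (rootAlgebra f)) = (invariantOrder g : Set (rootAlgebra g)) := by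
  ext y
  constructor
  · rintro ⟨x, hx, rfl⟩
    rw [h ⟨x, hx⟩]
    exact (φ _).2
  · intro hy
    refine ⟨φ.symm ⟨y, hy⟩, (φ.symm ⟨y, hy⟩).2, ?_⟩
    rw [h, φ.apply_symm_apply]

theorem mem_powerLattice_iff_of_monic (hf : f.natDegree = n) (hn : 2 ≤ n) (hm : f.Monic)
    {x : rootAlgebra f} : x ∈ powerLattice n f ↔ x ∈ invariantOrder f := by
  constructor
  · intro hx
    have hα : rootClass f ∈ invariantOrder f := by
      have h1 : zetaElt f 1 ∈ invariantOrder f := zetaElt_mem_orderSpan f (by omega)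
      simpa [zetaElt, hm.coeff_natDegree] using h1
    rw [powerLattice] at hx
    induction hx using Submodule.span_induction with
    | zero => exact zero_mem _
    | add u v _ _ hu hv => exact add_mem hu hv
    | smul m u _ hu => exact zsmul_mem hu m
    | mem x hx =>
      obtain ⟨j, rfl⟩ := hx
      exact pow_mem hα _
  · intro hx
    have h1 := mul_mem_powerLattice hf (aeval_rootClass_self f)
      ((mem_invariantOrder_iff hf (by omega)).1 hx)
      (Submodule.subset_span ⟨⟨0, by omega⟩, pow_zero _⟩ : (1 : rootAlgebra f) ∈ powerLattice n f)
    rwa [mul_one] at h1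

theorem exists_algHom_of_ringHom (hf : f.natDegree = n) (hn : 2 ≤ n) (hm : f.Monic)
    (φ : invariantOrder f →+* invariantOrder g) :
    ∃ Φ : rootAlgebra f →ₐ[ℚ] rootAlgebra g,
      ∀ x : invariantOrder f, Φ (x : rootAlgebra f) = (φ x : rootAlgebra g) := by
  have hα : rootClass f ∈ invariantOrder f := by
    rw [← mem_powerLattice_iff_of_monic hf hn hm]
    exact Submodule.subset_span ⟨⟨1, by omega⟩, pow_one _⟩
  have haeval : ∀ p : ℤ[X], aeval (rootClass f) p
      = ((aeval (⟨rootClass f, hα⟩ : invariantOrder f) p : invariantOrder f) : rootAlgebra f) := by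
    intro p
    have h := hom_eval₂ p (algebraMap ℤ (invariantOrder f)) (invariantOrder f).subtype
      ⟨rootClass f, hα⟩
    refine Eq.trans ?_ h.symm
    rw [aeval_def]
    congr 1
  let θ : rootAlgebra g := (invariantOrder g).subtype (φ ⟨rootClass f, hα⟩)
  have hφ : ∀ p : ℤ[X], ((φ (aeval (⟨rootClass f, hα⟩ : invariantOrder f) p) :
      invariantOrder g) : rootAlgebra g) = p.eval₂ (Int.castRingHom _) θ := by
    intro p
    have h := hom_eval₂ p (algebraMap ℤ (invariantOrder f))
      ((invariantOrder g).subtype.comp φ) ⟨rootClass f, hα⟩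
    refine Eq.trans h ?_
    congr 1
    exact RingHom.ext_int _ _
  have hroot : (f.map (Int.castRingHom ℚ)).eval₂ (Algebra.ofId ℚ (rootAlgebra g)) θ = 0 := by
    have h0 : aeval (⟨rootClass f, hα⟩ : invariantOrder f) f = 0 :=
      Subtype.ext ((haeval f).symm.trans (aeval_rootClass_self f))
    have h1 := hφ f
    rw [h0, map_zero] at h1
    rw [eval₂_map]
    refine Eq.trans ?_ h1.symm
    congr 1
  refine ⟨AdjoinRoot.liftAlgHom _ _ θ hroot, fun x => ?_⟩
  obtain ⟨p, -, hp⟩ := mem_powerLattice_iff.1 ((mem_powerLattice_iff_of_monic hf hn hm).2 x.2)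
  have hx : x = aeval (⟨rootClass f, hα⟩ : invariantOrder f) p :=
    Subtype.ext (hp.symm.trans (haeval p))
  rw [hx, hφ, ← haeval, aeval_rootClass, AdjoinRoot.liftAlgHom_mk, eval₂_map]
  congr 1

/-- For monic polynomials the invariant orders span the algebras over `ℚ` and are generated by
`α`, so that their isomorphisms extend. -/
theorem exists_algEquiv_of_ringEquiv (hf : f.natDegree = n) (hg : g.natDegree = n) (hn : 2 ≤ n)
    (hfm : f.Monic) (hgm : g.Monic) (φ : invariantOrder f ≃+* invariantOrder g) :
    ∃ Φ : rootAlgebra f ≃ₐ[ℚ] rootAlgebra g,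
      ∀ x : invariantOrder f, Φ (x : rootAlgebra f) = (φ x : rootAlgebra g) := by
  obtain ⟨Φ, hΦ⟩ := exists_algHom_of_ringHom hf hn hfm (φ : invariantOrder f →+* invariantOrder g)
  obtain ⟨Ψ, hΨ⟩ := exists_algHom_of_ringHom hg hn hgm
    (φ.symm : invariantOrder g →+* invariantOrder f)
  have hα : ∀ {p : ℤ[X]}, p.natDegree = n → p.Monic → rootClass p ∈ invariantOrder p := by
    intro p hp hm
    rw [← mem_powerLattice_iff_of_monic hp hn hm]
    exact Submodule.subset_span ⟨⟨1, by omega⟩, pow_one _⟩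
  refine ⟨AlgEquiv.ofAlgHom Φ Ψ (AdjoinRoot.algHom_ext ?_) (AdjoinRoot.algHom_ext ?_), hΦ⟩
  · have h1 := hΨ ⟨_, hα hg hgm⟩
    have h2 := hΦ (φ.symm ⟨_, hα hg hgm⟩)
    change Φ (Ψ (rootClass g)) = rootClass g
    rw [h1]
    exact h2.trans (congrArg Subtype.val (φ.apply_symm_apply _))
  · have h1 := hΦ ⟨_, hα hf hfm⟩
    have h2 := hΨ (φ ⟨_, hα hf hfm⟩)
    change Ψ (Φ (rootClass f)) = rootClass f
    rw [h1]
    exact h2.trans (congrArg Subtype.val (φ.symm_apply_apply _))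

theorem mapsToMultiple_of_monic (hf : f.natDegree = n) (hg : g.natDegree = n) (hn : 2 ≤ n)
    (hfm : f.Monic) (hgm : g.Monic) {Φ : rootAlgebra f ≃ₐ[ℚ] rootAlgebra g}
    (hR : Φ '' (invariantOrder f : Set (rootAlgebra f)) =
      (invariantOrder g : Set (rootAlgebra g))) :
    MapsToMultiple Φ (invariantIdeal f ^ (n - 1)) (invariantIdeal g ^ (n - 1)) := by
  refine (mapsToMultiple_iff hf hg (by omega) Φ).2 ⟨1, ?_⟩
  have h : ∀ {p : ℤ[X]}, p.natDegree = n → p.Monic →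
      (powerLattice n p : Set (rootAlgebra p)) = invariantOrder p := fun hp hm =>
    Set.ext fun x => mem_powerLattice_iff_of_monic hp hn hm
  rw [h hf hfm, h hg hgm, hR]
  simp

theorem hermiteEquivalent_iff_exists_ringEquiv (hn : 2 ≤ n) (hf : f.natDegree = n)
    (hg : g.natDegree = n) (hfd : f.discr ≠ 0) (hgd : g.discr ≠ 0) :
    HermiteEquivalent n f g ↔ ∃ φ : invariantOrder f ≃+* invariantOrder g,
      SameIdealClassUnder φ (invariantIdeal f ^ (n - 1)) (invariantIdeal g ^ (n - 1)) := by
  constructor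
  · intro h
    obtain ⟨-, Φ, hΦ⟩ := h.exists_algEquiv hn hf hg hfd hgd
    obtain ⟨φ, hφ⟩ :=
      exists_ringEquiv_of_image (h.image_invariantOrder hn hf hg hfd hgd hΦ)
    exact ⟨φ, Φ, hφ, hΦ⟩
  · rintro ⟨φ, Φ, hφ, hΦ⟩
    exact hermiteEquivalent_of_image hn hf hg hfd hgd (image_of_ringEquiv hφ) hΦ

end Comparison

end

theorem theorem1p1 (n : ℕ) (hn : 2 ≤ n) :
    (∀ f g : ℤ[X], f.natDegree = n → g.natDegree = n → f.discr ≠ 0 → g.discr ≠ 0 →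
      (HermiteEquivalent n f g ↔
        ∃ φ : invariantOrder f ≃+* invariantOrder g,
          SameIdealClassUnder φ (invariantIdeal f ^ (n - 1)) (invariantIdeal g ^ (n - 1))) ∧
      (HermiteEquivalent n f g →
        ∀ Φ : rootAlgebra f ≃ₐ[ℚ] rootAlgebra g,
          MapsToMultiple Φ (invariantIdeal f ^ (n - 1)) (invariantIdeal g ^ (n - 1)) →
            Φ '' (invariantOrder f : Set (rootAlgebra f))
              = (invariantOrder g : Set (rootAlgebra g)))) ∧
    (∀ f g : ℤ[X], f.Monic → g.Monic → f.natDegree = n → g.natDegree = n →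
      f.discr ≠ 0 → g.discr ≠ 0 →
      (HermiteEquivalent n f g ↔ Nonempty (invariantOrder f ≃+* invariantOrder g))) ∧
    (∀ f g : ℤ[X], f.natDegree = n → g.natDegree = n →
      GL2Equivalent n f g → HermiteEquivalent n f g) ∧
    (∀ f g : ℤ[X], f.Monic → g.Monic → f.natDegree = n → g.natDegree = n →
      ZEquivalent n f g → HermiteEquivalent n f g) := by
  refine ⟨fun f g hf hg hfd hgd => ⟨hermiteEquivalent_iff_exists_ringEquiv hn hf hg hfd hgd,
    fun h Φ hΦ => h.image_invariantOrder hn hf hg hfd hgd hΦ⟩,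
    fun f g hfm hgm hf hg hfd hgd => ⟨fun h => ?_, fun ⟨φ⟩ => ?_⟩,
    fun f g hf hg h => h.hermiteEquivalent hn hf hg,
    fun f g _ _ hf hg h => h.hermiteEquivalent hn hf hg⟩
  · obtain ⟨φ, -⟩ := (hermiteEquivalent_iff_exists_ringEquiv hn hf hg hfd hgd).1 h
    exact ⟨φ⟩
  · obtain ⟨Φ, hΦ⟩ := exists_algEquiv_of_ringEquiv hf hg hn hfm hgm φ
    have hR := image_of_ringEquiv hΦ
    exact hermiteEquivalent_of_image hn hf hg hfd hgd hR
      (mapsToMultiple_of_monic hf hg hn hfm hgm hR)
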